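/- All lattices are even integral lattices, and a root is a vector of square $-2$. Let $\Sigma=\mathbf A_{19}$ be the negative definite root lattice with its standard basis $\sigma$ of simple roots, and let $S=\Sigma\oplus\langle h\rangle$, $h^2=2$. A *configuration* extending $\Sigma$ is a finite index extension $\tilde S\supset S$ such that (1) the roots of the orthogonal complement $h^\perp$ of $h$ in $\tilde S$ generate $\Sigma$, and (2) there is no root $r\in\Sigma$ with $\frac12(r+h)\in\tilde S$. An *abstract homological type* extending $(\Sigma,\sigma)$ is an extension of $S$ to a lattice $L\cong 2\mathbf E_8\oplus 3\mathbf U$ (where $\mathbf E_8$ is the negative definite root lattice and $\mathbf U$ is the hyperbolic plane) such that the primitive hull $\tilde S$ of $S$ in $L$ is a configuration; one says that it extends the configuration $\tilde S$. Isomorphisms of configurations and of abstract homological types are isometries that take $S$ to $S$, $h$ to $h$ and $\sigma$ to $\sigma$ (as a set). An abstract homological type is *symmetric* if it has an automorphism whose restriction to $\tilde S^\perp\subset L$ reverses the orientation of the maximal positive definite subspaces of $\tilde S^\perp\otimes\mathbb R$ (orientations of two such subspaces being compared by means of the orthogonal projection). Let $\mathbf M(1,0,10)$ be the lattice of rank $2$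 with Gram matrix $\begin{bmatrix}2&0\\0&20\end{bmatrix}$. **Proposition.** The set of singularities $\Sigma=\mathbf A_{19}$ admits a configuration $\tilde S$, and it is unique up to isomorphism. This configuration extends to exactly two abstract homological types, up to isomorphism. Both are symmetric, and for both of them $\tilde S^\perp\cong\mathbf M(1,0,10)$; in particular, the two lattices $\tilde S^\perp$ are isomorphic. -/

import Mathlib

open scoped TensorProduct

noncomputable section

/-- An even integral lattice: a finitely generated free abelian group with a symmetric bilinear
form `L ⊗ L → ℤ` such that `x ^ 2 = x · x` is even for all `x`. -/
structure EvenLattice where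
  carrier : Type
  [addCommGroup : AddCommGroup carrier]
  [free : Module.Free ℤ carrier]
  [finite : Module.Finite ℤ carrier]
  form : LinearMap.BilinForm ℤ carrier
  symm : ∀ x y, form x y = form y x
  even : ∀ x, Even (form x x)

namespace EvenLattice

instance : CoeSort EvenLattice Type := ⟨EvenLattice.carrier⟩

instance (L : EvenLattice) : AddCommGroup L := L.addCommGroup
instance (L : EvenLattice) : Module.Free ℤ L := L.free
instance (L : EvenLattice) : Module.Finite ℤ L := L.finite

/-- An isometry (isomorphism of lattices). -/
structure Isometry (L M : EvenLattice) where
  toEquiv : L ≃ₗ[ℤ] M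
  form_map : ∀ x y, M.form (toEquiv x) (toEquiv y) = L.form x y

instance (L M : EvenLattice) : CoeFun (Isometry L M) (fun _ => L → M) := ⟨fun f => f.toEquiv⟩

/-- Two lattices are isomorphic if there is an isometry between them. -/
def IsIsomorphic (L M : EvenLattice) : Prop := Nonempty (Isometry L M)

/-- The orthogonal direct sum of two even lattices. -/
abbrev directSum (L M : EvenLattice) : EvenLattice where
  carrier := L × M
  form := L.form.compl₁₂ (LinearMap.fst ℤ L M) (LinearMap.fst ℤ L M) +
    M.form.compl₁₂ (LinearMap.snd ℤ L M) (LinearMap.snd ℤ L M)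
  symm x y := by simp [L.symm x.1 y.1, M.symm x.2 y.2]
  even x := by simpa using (L.even x.1).add (M.even x.2)

/-- The orthogonal direct sum `L ⊕ M`. -/
scoped infixr:65 " ⊞ " => EvenLattice.directSum

/-- A subgroup of an even lattice, with the restricted form. -/
abbrev sublattice (L : EvenLattice) (P : Submodule ℤ L) : EvenLattice where
  carrier := P
  form := L.form.restrict P
  symm x y := L.symm x y
  even x := L.even x

theorem toBilin_even {ι : Type} [Fintype ι] [DecidableEq ι] (G : Matrix ι ι ℤ) (hs : G.IsSymm)
    (hd : ∀ i, Even (G i i)) (x : ι → ℤ) : Even (Matrix.toBilin' G x x) := by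
  have hadd : ∀ u v : ι → ℤ, Matrix.toBilin' G u v = Matrix.toBilin' G v u := by
    intro u v
    simp only [Matrix.toBilin'_apply]
    rw [Finset.sum_comm]
    refine Finset.sum_congr rfl fun i _ => Finset.sum_congr rfl fun j _ => ?_
    rw [hs.apply]; ring
  have key : ∀ s : Finset ι, Even (Matrix.toBilin' G (∑ i ∈ s, Pi.single i (x i))
      (∑ i ∈ s, Pi.single i (x i))) := by
    intro s
    induction s using Finset.induction_on with
    | empty => simp
    | insert a s ha ih =>
      rw [Finset.sum_insert ha]
      generalize (∑ i ∈ s, Pi.single i (x i) : ι → ℤ) = v at ih ⊢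
      simp only [map_add, LinearMap.add_apply]
      rw [hadd v (Pi.single a (x a))]
      have h1 : Even (Matrix.toBilin' G (Pi.single a (x a)) (Pi.single a (x a))) := by
        have : (Pi.single a (x a) : ι → ℤ) = x a • Pi.single a 1 := by
          rw [← Pi.single_smul]; simp
        rw [this]
        simp only [map_smul, LinearMap.smul_apply, Matrix.toBilin'_single, smul_eq_mul]
        exact ((hd a).mul_left _).mul_left _
      have h2 := Even.add h1 ih
      obtain ⟨k, hk⟩ := h2
      exact ⟨k + Matrix.toBilin' G (Pi.single a (x a)) v, by linarith⟩
  have := key Finset.univ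
  rwa [Finset.univ_sum_single] at this

/-- The even lattice `ℤ^ι` with the given (symmetric, even on the diagonal) Gram matrix. -/
abbrev ofGram {ι : Type} [Fintype ι] [DecidableEq ι] (G : Matrix ι ι ℤ) (hs : G.IsSymm)
    (hd : ∀ i, Even (G i i)) : EvenLattice where
  carrier := ι → ℤ
  form := Matrix.toBilin' G
  symm x y := by
    simp only [Matrix.toBilin'_apply]
    rw [Finset.sum_comm]
    refine Finset.sum_congr rfl fun i _ => Finset.sum_congr rfl fun j _ => ?_
    rw [hs.apply]; ring
  even := toBilin_even G hs hd

/-- The hyperbolic plane `U`. -/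
abbrev hyperbolicPlane : EvenLattice :=
  ofGram !![0, 1; 1, 0] (by decide) (by decide)

/-- The negative definite root lattice `E₈`. -/
abbrev latticeE8 : EvenLattice :=
  ofGram (-CartanMatrix.E₈) CartanMatrix.E₈_isSymm.neg (by decide)

/-- The negative definite root lattice `A_p`, in its standard basis of simple roots. -/
abbrev latticeA (p : ℕ) : EvenLattice :=
  ofGram (-CartanMatrix.A p) (CartanMatrix.A_isSymm p).neg
    (fun i => by simp [CartanMatrix.A])

/-- The standard basis (the set of simple roots) of `A_p`. -/
def basisA (p : ℕ) : Set (latticeA p) :=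
  Set.range fun i : Fin p => (Pi.single i 1 : Fin p → ℤ)

/-- The rank one lattice `⟨h⟩` with `h ^ 2 = 2`. -/
abbrev latticeH : EvenLattice :=
  ofGram !![2] (by decide) (by decide)

/-- The lattice `M(a, b, c)` of rank `2` with the Gram matrix `[2a, b; b, 2c]`. -/
abbrev latticeM (a b c : ℤ) : EvenLattice :=
  ofGram !![2 * a, b; b, 2 * c] (by ext i j; fin_cases i <;> fin_cases j <;> rfl)
    (fun i => by fin_cases i <;> simp)

/-- The lattice `2E₈ ⊕ 3U`. -/
abbrev latticeK3 : EvenLattice :=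
  latticeE8 ⊞ latticeE8 ⊞ hyperbolicPlane ⊞ hyperbolicPlane ⊞ hyperbolicPlane

/-- The real vector space `L ⊗ ℝ`. -/
abbrev realSpace (L : EvenLattice) : Type := ℝ ⊗[ℤ] L

/-- The real extension of the form of `L`. -/
def realForm (L : EvenLattice) : LinearMap.BilinForm ℝ L.realSpace :=
  LinearMap.BilinForm.baseChange ℝ L.form

/-- The real extension of an isometry. -/
def Isometry.real {L M : EvenLattice} (t : Isometry L M) : L.realSpace →ₗ[ℝ] M.realSpace :=
  LinearMap.baseChange ℝ (t.toEquiv : L →ₗ[ℤ] M)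

/-- `W` is a maximal positive definite subspace of `L ⊗ ℝ`. -/
def IsMaxPosDef (L : EvenLattice) (W : Submodule ℝ L.realSpace) : Prop :=
  Maximal (fun W' : Submodule ℝ L.realSpace => ∀ x ∈ W', x ≠ 0 → 0 < L.realForm x x) W

/-- `t` is `+`-disorienting: it reverses the (coherent) orientation of the maximal positive
definite subspaces of `L ⊗ ℝ`. Here `p : W → W` is the composition of `t : W → t(W)` and of the
orthogonal projection `t(W) → W`, by means of which the orientations of the subspaces `t(W)` and
`W` are compared. -/
def Isometry.IsPlusDisorienting {L : EvenLattice} (t : Isometry L L) : Prop :=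
  ∃ (W : Submodule ℝ L.realSpace) (p : W →ₗ[ℝ] W), L.IsMaxPosDef W ∧
    (∀ x y : W, L.realForm y (t.real x - p x) = 0) ∧ LinearMap.det p < 0

/-- An extension of an even lattice `S`: an even lattice `L` containing `S`, i.e. together with an
isometric embedding of `S`. -/
structure Extension (S : EvenLattice) where
  L : EvenLattice
  emb : S →ₗ[ℤ] L
  injective : Function.Injective emb
  form_emb : ∀ x y, L.form (emb x) (emb y) = S.form x y

namespace Extension

variable {S : EvenLattice}

/-- For a subset `A` of `O(S)`, an isometry `f : L₁ → L₂` between two extensions of `S` is an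
`A`-isomorphism if it restricts to an isometry `S → S` that belongs to `A`. -/
def IsAIso (A : Set (Isometry S S)) (E₁ E₂ : Extension S) (f : Isometry E₁.L E₂.L) : Prop :=
  ∃ s ∈ A, ∀ x, f (E₁.emb x) = E₂.emb (s x)

/-- The primitive hull of `S` in an extension `L`, as a subgroup of `L`. -/
def hull (E : Extension S) : Submodule ℤ E.L where
  carrier := {x | ∃ n : ℤ, n ≠ 0 ∧ n • x ∈ LinearMap.range E.emb}
  zero_mem' := ⟨1, one_ne_zero, by simp⟩
  add_mem' := by
    rintro x y ⟨m, hm, hx⟩ ⟨n, hn, hy⟩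
    refine ⟨m * n, mul_ne_zero hm hn, ?_⟩
    have h : (m * n) • (x + y) = n • (m • x) + m • (n • y) := by
      rw [smul_add, smul_smul, smul_smul, mul_comm n m]
    rw [h]
    exact add_mem (Submodule.smul_mem _ _ hx) (Submodule.smul_mem _ _ hy)
  smul_mem' := by
    rintro c x ⟨n, hn, hx⟩
    refine ⟨n, hn, ?_⟩
    rw [smul_comm]
    exact Submodule.smul_mem _ _ hx

theorem emb_mem_hull (E : Extension S) (x : S) : E.emb x ∈ E.hull :=
  ⟨1, one_ne_zero, by simp⟩

/-- The primitive hull `S̃` of `S` in `L`, as an extension of `S`. -/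
abbrev hullExtension (E : Extension S) : Extension S where
  L := E.L.sublattice E.hull
  emb := E.emb.codRestrict E.hull E.emb_mem_hull
  injective := fun _ _ h => E.injective (congrArg Subtype.val h)
  form_emb := E.form_emb

/-- The orthogonal complement `S̃^⊥` of the primitive hull of `S` in `L`. -/
abbrev perp (E : Extension S) : EvenLattice :=
  E.L.sublattice (E.L.form.orthogonal E.hull)

end Extension

section Sextics

/-- The lattice `S = Σ ⊕ ⟨h⟩`, `h ^ 2 = 2`. In the definitions below `Σ` is a root system (the set
of singularities) and `σ ⊂ Σ` is its distinguished standard basis. -/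
abbrev polarized (Sg : EvenLattice) : EvenLattice := Sg ⊞ latticeH

variable (Sg : EvenLattice)

/-- The distinguished vector `h ∈ S`. -/
def vecH : polarized Sg := ((0 : Sg), (fun _ => 1 : Fin 1 → ℤ))

/-- The inclusion `Σ → S`. -/
def inclSigma : Sg →ₗ[ℤ] polarized Sg := LinearMap.inl ℤ Sg latticeH

/-- The group `O_h(S)` of admissible isometries of `S`: those preserving `h` and preserving `σ` as
a set. -/
def admissible (σ : Set Sg) : Set (Isometry (polarized Sg) (polarized Sg)) :=
  {s | s (vecH Sg) = vecH Sg ∧ s '' (inclSigma Sg '' σ) = inclSigma Sg '' σ}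

variable {Sg}

/-- A configuration: a finite index extension `S̃` of `S = Σ ⊕ ⟨h⟩` such that
(1) the roots (vectors of square `-2`) of the orthogonal complement of `h` in `S̃` generate `Σ`;
(2) there is no root `r ∈ Σ` such that `(r + h) / 2 ∈ S̃`. -/
structure IsConfiguration (E : Extension (polarized Sg)) : Prop where
  finiteIndex : (LinearMap.range E.emb).toAddSubgroup.FiniteIndex
  roots : Submodule.span ℤ {r : E.L | E.L.form (E.emb (vecH Sg)) r = 0 ∧ E.L.form r r = -2} =
    LinearMap.range (E.emb ∘ₗ inclSigma Sg)
  noHalf : ¬ ∃ r : Sg, Sg.form r r = -2 ∧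
    ∃ x : E.L, (2 : ℤ) • x = E.emb (inclSigma Sg r) + E.emb (vecH Sg)

/-- An abstract homological type extending `(Σ, σ)`: an extension of `S = Σ ⊕ ⟨h⟩` to a lattice `L`
isomorphic to `2E₈ ⊕ 3U` such that the primitive hull of `S` in `L` is a configuration. -/
structure IsHomologicalType (E : Extension (polarized Sg)) : Prop where
  isK3 : E.L.IsIsomorphic latticeK3
  hull : IsConfiguration E.hullExtension

/-- Isomorphism of extensions of `S` (of configurations, of abstract homological types): an isometry
taking `h` to `h` and `σ` to `σ` (as a set). -/
def AreIsomorphic (σ : Set Sg) (E₁ E₂ : Extension (polarized Sg)) : Prop :=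
  ∃ f : Isometry E₁.L E₂.L, Extension.IsAIso (admissible Sg σ) E₁ E₂ f

/-- An abstract homological type is symmetric if it has an automorphism `f` whose restriction `t`
to `S̃^⊥` is `+`-disorienting. -/
def IsSymmetric (σ : Set Sg) (E : Extension (polarized Sg)) : Prop :=
  ∃ f : Isometry E.L E.L, Extension.IsAIso (admissible Sg σ) E E f ∧
    ∃ t : Isometry E.perp E.perp, (∀ x : E.perp, (t x).val = f x.val) ∧ t.IsPlusDisorienting

end Sextics

end EvenLattice

end

open EvenLattice

/-! Everything is read off discriminant forms. Write ω for the element of the dual of A₁₉ that is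
dual to the first simple root, ω² = -19/20. The discriminant group of S is ℤ/20 ⊕ ℤ/2, generated by
ω and h/2. A vector kω + lh/2 of an even extension has even square, so 40 divides 10l² - 19k², and
this forces 20 ∣ k and 2 ∣ l. Hence S has no proper even extension of finite index: S itself is the
only configuration, and S is primitive in every L (`mem_range_of_mem_hull`).

Since 2E₈ ⊕ 3U is unimodular of signature (3, 19), the complement T of S in L is positive definite
of rank 2 (`form_self_pos_of_isPerp`) and has determinant 40 (`det_perp`). Gauss reduction leaves
two diagonal forms, [2, 20] and [4, 10]. The lattice L is generated by S ⊕ T and two glue vectors,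
projecting to ω and to h/2 in the dual of S. Evenness of their squares excludes [4, 10], since 2 is
not a square modulo 5. For [2, 20], with orthogonal generators t₁, t₂ of T, the glue vectors are,
modulo T, ω + t₁/2 + k t₂/20 and h/2 + t₁/2 + t₂/2, with k ≡ ±3 or ±7 modulo 20; changing the sign
of t₂ leaves k = 3 or k = 7 (`exists_fullFrame`). The number k determines all products of the
generators, hence the extension up to isomorphism (`FullFrame.exists_isometry`).

Conversely, k modulo 20 and up to sign is an invariant. The Dynkin graph has no symmetry but the
reversal, so isomorphisms send ω to ±ω modulo A₁₉, and the isometries of T only change the signs of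
t₁ and t₂ (`GlueFrame.exists_of_areIsomorphic`, `FullFrame.congr_of_glueFrame`). Both values of k
are realized by explicit vectors. Finally, t₁ ↦ -t₁ preserves the glue modulo T, so it extends to an
automorphism that is the identity on S; its determinant on the definite lattice T is -1, whence the
symmetry. -/

open EvenLattice

noncomputable section

namespace EvenLattice

open scoped TensorProduct

/-! ### The lattices A₁₉ and S -/

/-- The simple root `e_i` of `A_p`. -/
def simpleRoot {p : ℕ} (i : Fin p) : latticeA p := (Pi.single i 1 : Fin p → ℤ)

/-- The vector `20 ω` of `A₁₉`, where `ω` is dual to the first simple root. -/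
def weightVec : latticeA 19 := fun i : Fin 19 => (i : ℤ) - 19

theorem latticeA_form_eq_dotProduct (p : ℕ) (a b : latticeA p) :
    (latticeA p).form a b = dotProduct a (Matrix.mulVec (-CartanMatrix.A p) b) :=
  Matrix.toBilin'_apply' _ _ _

theorem latticeA_form_simpleRoot (p : ℕ) (i j : Fin p) :
    (latticeA p).form (simpleRoot i) (simpleRoot j) = -CartanMatrix.A p i j :=
  Matrix.toBilin'_single _ _ _

theorem sum_smul_simpleRoot {p : ℕ} (a : latticeA p) :
    a = ∑ i, (a i) • (simpleRoot i : latticeA p) := by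
  ext j
  simp [simpleRoot, Finset.sum_apply, Pi.single_apply]

theorem form_sum_smul_left (L : EvenLattice) {ι : Type} [Fintype ι] (c : ι → ℤ) (v : ι → L)
    (w : L) : L.form (∑ i, c i • v i) w = ∑ i, c i * L.form (v i) w := by
  simp

theorem form_sum_smul_right (L : EvenLattice) {ι : Type} [Fintype ι] (c : ι → ℤ) (v : ι → L)
    (w : L) : L.form w (∑ i, c i • v i) = ∑ i, c i * L.form w (v i) := by
  simp

theorem latticeA_form_simpleRoot_right {p : ℕ} (a : latticeA p) (j : Fin p) :
    (latticeA p).form a (simpleRoot j) = ∑ i, a i * -CartanMatrix.A p i j := by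
  conv_lhs => rw [sum_smul_simpleRoot a]
  rw [form_sum_smul_left]
  exact Finset.sum_congr rfl fun i _ => by rw [latticeA_form_simpleRoot]

theorem form_weightVec (a : latticeA 19) :
    (latticeA 19).form weightVec a = 20 * a 0 := by
  have h : ∀ j : Fin 19, (∑ i : Fin 19, ((i : ℤ) - 19) * -CartanMatrix.A 19 i j) =
      if j = 0 then 20 else 0 := by decide +kernel
  conv_lhs => rw [sum_smul_simpleRoot a]
  rw [form_sum_smul_right]
  have h' : ∀ j : Fin 19, (latticeA 19).form weightVec (simpleRoot j) =
      if j = 0 then 20 else 0 := fun j => (latticeA_form_simpleRoot_right _ _).trans (h j)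
  rw [Finset.sum_congr rfl fun i _ => by rw [h' i]]
  simp [mul_comm]

theorem weightVec_zero : weightVec 0 = -19 := by decide

theorem form_weightVec_self : (latticeA 19).form weightVec weightVec = -380 := by
  rw [form_weightVec, weightVec_zero]; norm_num

theorem form_weightVec_simpleRoot (i : Fin 19) :
    (latticeA 19).form weightVec (simpleRoot i) = if i = 0 then 20 else 0 := by
  rw [form_weightVec]
  by_cases h : i = 0
  · subst h; simp [simpleRoot]
  · simp [simpleRoot, h]

/-- The differences of the coordinates: an embedding of `-A₁₉` into `ℤ²⁰`. -/
def diffMatrix : Matrix (Fin 20) (Fin 19) ℤ := fun r i =>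
  if (r : ℕ) = i then 1 else if (r : ℕ) = i + 1 then -1 else 0

theorem diffMatrix_gram : diffMatrix.transpose * diffMatrix = CartanMatrix.A 19 := by
  decide +kernel

theorem form_self_eq_neg (a : latticeA 19) : (latticeA 19).form a a =
    -∑ r, (diffMatrix.mulVec a) r * (diffMatrix.mulVec a) r := by
  rw [latticeA_form_eq_dotProduct, ← diffMatrix_gram, Matrix.neg_mulVec, dotProduct_neg,
    ← Matrix.mulVec_mulVec, Matrix.dotProduct_mulVec, Matrix.vecMul_transpose]
  rfl

theorem form_self_nonpos (a : latticeA 19) : (latticeA 19).form a a ≤ 0 := by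
  rw [form_self_eq_neg]
  simpa using Finset.sum_nonneg fun r _ => mul_self_nonneg ((diffMatrix.mulVec a) r)

theorem eq_zero_of_form_self_eq_zero {a : latticeA 19} (h : (latticeA 19).form a a = 0) :
    a = 0 := by
  have hB : diffMatrix.mulVec a = 0 := by
    ext r
    rw [form_self_eq_neg, neg_eq_zero,
      Finset.sum_eq_zero_iff_of_nonneg fun r _ => mul_self_nonneg _] at h
    simpa using h r (Finset.mem_univ r)
  -- The rows 0, …, i telescope to the i-th coordinate functional.
  have h1 : ∀ i : Fin 19, (∑ r : Fin 20, (if (r : ℕ) ≤ i then (1 : ℤ) else 0) •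
      diffMatrix r) = Pi.single i 1 := by decide +kernel
  ext i
  have h2 := congrArg (fun f => dotProduct f a) (h1 i)
  simp only [single_dotProduct, one_mul] at h2
  rw [← h2, sum_dotProduct]
  refine Finset.sum_eq_zero fun r _ => ?_
  rw [smul_dotProduct]
  have h3 : dotProduct (diffMatrix r) a = 0 := congrFun hB r
  rw [h3, smul_zero]

theorem eq_zero_of_form_simpleRoot {a : latticeA 19}
    (h : ∀ i, (latticeA 19).form a (simpleRoot i) = 0) : a = 0 := by
  apply eq_zero_of_form_self_eq_zero
  have h1 := form_sum_smul_right (latticeA 19) a simpleRoot a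
  rw [← sum_smul_simpleRoot a] at h1
  rw [h1]
  exact Finset.sum_eq_zero fun i _ => by rw [h i, mul_zero]

/-- Prescribed products with all simple roots but the first one. -/
theorem exists_form_simpleRoot_eq (f : Fin 19 → ℤ) :
    ∃ a : latticeA 19, ∀ i, i ≠ 0 → (latticeA 19).form a (simpleRoot i) = f i := by
  -- The form takes second differences of coordinates, and max(l - i, 0) is piecewise linear in i
  -- with its only bend at i = l. The first root is excluded because its left neighbour is missing.
  have h : ∀ l : Fin 19, ∀ j : Fin 19, j ≠ 0 →
      (∑ i : Fin 19, ((l : ℤ) - i).toNat * -CartanMatrix.A 19 i j) =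
        if l = j then 1 else 0 := by decide +kernel
  refine ⟨∑ l : Fin 19, f l • (fun i : Fin 19 => (((l : ℤ) - i).toNat : ℤ)), fun j hj => ?_⟩
  rw [form_sum_smul_left]
  have h' : ∀ l : Fin 19, (latticeA 19).form (fun i : Fin 19 => (((l : ℤ) - i).toNat : ℤ))
      (simpleRoot j) = if l = j then 1 else 0 :=
    fun l => (latticeA_form_simpleRoot_right _ _).trans (h l j hj)
  rw [Finset.sum_congr rfl fun i _ => by rw [h' i]]
  simp

theorem polarized_form_apply (x y : polarized (latticeA 19)) :
    (polarized (latticeA 19)).form x y =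
      (latticeA 19).form x.1 y.1 + 2 * (x.2 0 * y.2 0) := by
  have : latticeH.form x.2 y.2 = 2 * (x.2 0 * y.2 0) := by
    simp [Matrix.toBilin'_apply]; ring
  rw [← this]; rfl

theorem polarized_eq_zero_of_form {x : polarized (latticeA 19)}
    (h : ∀ y, (polarized (latticeA 19)).form x y = 0) : x = 0 := by
  have h1 : x.1 = 0 := eq_zero_of_form_simpleRoot fun i => by
    have := h (simpleRoot i, 0)
    rw [polarized_form_apply] at this
    change _ + 2 * (x.2 0 * 0) = 0 at this
    rwa [mul_zero, mul_zero, add_zero] at this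
  have h2 : x.2 0 = 0 := by
    have := h (0, fun _ => 1)
    rw [polarized_form_apply] at this
    simpa using this
  refine Prod.ext h1 ?_
  ext i
  rw [Subsingleton.elim i 0]
  exact h2

/-- The homomorphism `A₁₉ ⊕ ⟨h⟩ → M` with prescribed images of the simple roots and of `h`. -/
def polarizedLift {M : EvenLattice} (v : Fin 19 → M) (w : M) :
    polarized (latticeA 19) →ₗ[ℤ] M :=
  (Fintype.linearCombination ℤ v) ∘ₗ LinearMap.fst ℤ (latticeA 19) latticeH +
    (LinearMap.toSpanSingleton ℤ M w) ∘ₗ (LinearMap.proj 0 : (Fin 1 → ℤ) →ₗ[ℤ] ℤ) ∘ₗ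
      LinearMap.snd ℤ (latticeA 19) latticeH

theorem polarizedLift_apply {M : EvenLattice} (v : Fin 19 → M) (w : M)
    (x : polarized (latticeA 19)) :
    polarizedLift v w x = ∑ i, x.1 i • v i + x.2 0 • w := rfl

/-- The extension of `A₁₉ ⊕ ⟨h⟩` defined by vectors with the right Gram matrix. -/
def extensionOfGram {M : EvenLattice} (v : Fin 19 → M) (w : M)
    (hv : ∀ i j, M.form (v i) (v j) = -CartanMatrix.A 19 i j)
    (hvw : ∀ i, M.form (v i) w = 0) (hw : M.form w w = 2) :
    Extension (polarized (latticeA 19)) :=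
  have key : ∀ x y, M.form (polarizedLift v w x) (polarizedLift v w y) =
      (polarized (latticeA 19)).form x y := fun x y => by
    have h1 : ∀ a : latticeA 19, M.form (∑ i, a i • v i) w = 0 := fun a => by
      rw [form_sum_smul_left]
      exact Finset.sum_eq_zero fun i _ => by rw [hvw, mul_zero]
    have h2 : ∀ a b : latticeA 19, M.form (∑ i, a i • v i) (∑ i, b i • v i) =
        (latticeA 19).form a b := fun a b => by
      conv_rhs => rw [sum_smul_simpleRoot b]
      rw [form_sum_smul_right, form_sum_smul_right]
      refine Finset.sum_congr rfl fun j _ => ?_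
      rw [latticeA_form_simpleRoot_right, form_sum_smul_left]
      simp only [hv]
    rw [polarized_form_apply, polarizedLift_apply, polarizedLift_apply]
    simp only [map_add, LinearMap.add_apply, h1, h2, map_smul, LinearMap.smul_apply, hw,
      M.symm w (∑ i, y.1 i • v i), smul_eq_mul]
    ring
  { L := M
    emb := polarizedLift v w
    -- A form-preserving map out of a nondegenerate lattice is injective.
    injective := (injective_iff_map_eq_zero _).2 fun x hx =>
      polarized_eq_zero_of_form fun y => by rw [← key, hx]; simp
    form_emb := key }

/-! ### Two explicit embeddings into 2E₈ ⊕ 3U -/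

/-- The element of `2E₈ ⊕ 3U` with the given coordinates. -/
def ofCoords (c : Fin 22 → ℤ) : latticeK3 :=
  (![c 0, c 1, c 2, c 3, c 4, c 5, c 6, c 7],
    ![c 8, c 9, c 10, c 11, c 12, c 13, c 14, c 15],
    ![c 16, c 17], ![c 18, c 19], ![c 20, c 21])

/-- The scalar product of two lists of integers. -/
def listDot : List ℤ → List ℤ → ℤ
  | a :: l, b :: m => a * b + listDot l m
  | _, _ => 0

/-- The products of an element of `2E₈ ⊕ 3U` with the standard basis. -/
def dualCoords (d : Fin 22 → ℤ) : List ℤ :=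
  [-2 * d 0 + d 2, -2 * d 1 + d 3, -2 * d 2 + d 0 + d 3, -2 * d 3 + d 1 + d 2 + d 4, -2 * d 4 + d 3 + d 5, -2 * d 5 + d 4 + d 6, -2 * d 6 + d 5 + d 7, -2 * d 7 + d 6, -2 * d 8 + d 10, -2 * d 9 + d 11, -2 * d 10 + d 8 + d 11, -2 * d 11 + d 9 + d 10 + d 12, -2 * d 12 + d 11 + d 13, -2 * d 13 + d 12 + d 14, -2 * d 14 + d 13 + d 15, -2 * d 15 + d 14, d 17, d 16, d 19, d 18, d 21, d 20]

theorem ofCoords_form (c d : Fin 22 → ℤ) :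
    latticeK3.form (ofCoords c) (ofCoords d) = listDot (List.ofFn c) (dualCoords d) := by
  have h1 : latticeK3.form (ofCoords c) (ofCoords d) =
    latticeE8.form (ofCoords c).1 (ofCoords d).1 +
    (latticeE8.form (ofCoords c).2.1 (ofCoords d).2.1 +
      (hyperbolicPlane.form (ofCoords c).2.2.1 (ofCoords d).2.2.1 +
        (hyperbolicPlane.form (ofCoords c).2.2.2.1 (ofCoords d).2.2.2.1 +
          hyperbolicPlane.form (ofCoords c).2.2.2.2 (ofCoords d).2.2.2.2))) := rfl
  have h2 : ∀ a0 a1 a2 a3 a4 a5 a6 a7 b0 b1 b2 b3 b4 b5 b6 b7 : ℤ,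
      latticeE8.form ![a0, a1, a2, a3, a4, a5, a6, a7] ![b0, b1, b2, b3, b4, b5, b6, b7] =
      a0 * (-2 * b0 + b2) + a1 * (-2 * b1 + b3) + a2 * (-2 * b2 + b0 + b3) +
      a3 * (-2 * b3 + b1 + b2 + b4) + a4 * (-2 * b4 + b3 + b5) + a5 * (-2 * b5 + b4 + b6) +
      a6 * (-2 * b6 + b5 + b7) + a7 * (-2 * b7 + b6) := by
    intros
    rw [show ∀ x y, latticeE8.form x y = dotProduct x ((-CartanMatrix.E₈).mulVec y) from
      Matrix.toBilin'_apply' _]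
    simp [Matrix.mulVec, dotProduct, Fin.sum_univ_succ, CartanMatrix.E₈]
    ring
  have h3 : ∀ a0 a1 b0 b1 : ℤ, hyperbolicPlane.form ![a0, a1] ![b0, b1] =
      a0 * b1 + a1 * b0 := by
    intros
    simp [Matrix.toBilin'_apply]
  rw [h1]
  simp only [ofCoords, h2, h3]
  simp only [List.ofFn_succ, List.ofFn_zero, dualCoords, listDot]
  simp only [Fin.succ_zero_eq_one, Fin.isValue]
  simp only [Fin.reduceSucc]
  ring

/-- Coordinates of the images of the simple roots and of `h` under the first embedding into
`2E₈ ⊕ 3U`, of two generators of the orthogonal complement, and of a glue vector. -/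
def tableOne : List (List ℤ) :=
  [[0, 0, 0, 0, 0, -1, 0, 0, 0, 0, 0, 0, 0, 0, 0, 0, 0, 1, 0, 0, 0, 1],
    [0, 0, 0, 0, 0, 0, 0, 0, 1, 2, 3, 4, 3, 2, 1, 0, 0, 0, 0, -1, 1, 0],
    [1, 1, 2, 2, 1, 1, 1, 0, -1, -2, -4, -5, -4, -2, -1, 0, 1, 0, 1, 2, -1, -1],
    [-1, -1, -2, -2, -1, -1, -1, 0, 0, 0, 1, 1, 1, 0, 0, 0, -1, 0, -1, -1, 1, 0],
    [0, 0, 0, 0, 0, 0, 0, 0, 1, 2, 3, 4, 3, 2, 1, 0, 0, 0, -1, 0, 0, 1],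
    [1, 1, 2, 2, 1, 2, 1, 0, -2, -4, -5, -7, -5, -4, -2, 0, 0, -1, 1, 0, -2, -2],
    [1, 2, 2, 4, 3, 1, 1, 1, 1, 2, 2, 3, 2, 2, 1, 0, 1, 1, 0, 0, 1, 1],
    [-2, -3, -4, -6, -5, -3, -2, -1, 0, 0, 0, 0, 0, 0, 0, 0, -1, 0, 0, 0, 0, 0],
    [0, 0, 0, 0, 1, 0, 0, 0, 1, 2, 3, 4, 3, 3, 2, 1, 0, 0, 0, 0, 1, 1],
    [0, 0, 0, 0, 0, 0, 0, 0, 0, 1, 0, 1, 1, 0, 0, 0, 0, 0, 0, 0, 0, 0],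
    [1, 1, 2, 2, 1, 1, 0, 0, -1, -3, -3, -5, -4, -3, -2, -1, 0, 0, 0, 0, -1, -1],
    [0, 0, 0, 1, 1, 1, 1, 0, 0, 0, 0, 0, 0, 0, 0, 0, 0, 0, 0, 0, 0, 0],
    [0, 1, 0, 0, 0, 0, 0, 0, 0, 0, 0, 0, 0, 0, 0, 0, 0, 0, 0, 0, 0, 0],
    [-1, -2, -2, -3, -2, -2, -1, 0, 2, 3, 4, 5, 4, 3, 2, 1, 0, 0, 0, 0, 1, 1],
    [0, 0, 0, 0, 0, 0, 0, 0, 0, 0, 0, 1, 0, 0, 0, 0, 0, 0, 0, 0, 0, 0],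
    [0, 0, 0, 0, 0, 0, 0, 0, 0, 0, 0, 0, 1, 1, 0, 0, 0, 0, 0, 0, 0, 0],
    [0, 0, 0, 0, 0, 0, 0, 0, 0, 0, 0, 0, 0, 0, 1, 0, 0, 0, 0, 0, 0, 0],
    [1, 2, 3, 4, 3, 3, 2, 1, -2, -3, -4, -6, -5, -4, -3, -1, 0, 0, 0, 0, -1, -1],
    [1, 0, 0, 0, 0, 0, 0, 0, 0, 0, 0, 0, 0, 0, 0, 0, 0, 0, 0, 0, 0, 0],
    [3, 4, 6, 8, 5, 5, 3, 1, -4, -7, -9, -13, -10, -8, -5, -2, 1, 0, 0, 0, -3, -3],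
    [1, 1, 2, 2, 1, 1, 1, 0, -1, -2, -4, -5, -4, -2, -1, 0, 1, 0, 2, 2, -1, -1],
    [0, 1, 0, 2, 2, -4, 0, 1, 7, 13, 15, 22, 16, 14, 8, 2, 4, 6, 0, 0, 6, 6],
    [0, 0, 0, 0, 0, 0, 0, 0, 0, 0, -1, -1, -1, 0, 0, 0, 1, 0, 1, 1, 0, 0]]

/-- The products of the rows of `tableOne` with the standard basis. -/
def dualTableOne : List (List ℤ) :=
  [[0, 0, 0, 0, -1, 2, -1, 0, 0, 0, 0, 0, 0, 0, 0, 0, 1, 0, 0, 0, 1, 0],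
    [0, 0, 0, 0, 0, 0, 0, 0, 1, 0, -1, 0, 0, 0, 0, 1, 0, 0, -1, 0, 0, 1],
    [0, 0, -1, 0, 1, 0, -1, 1, -2, -1, 2, 0, 1, -1, 0, -1, 0, 1, 2, 1, -1, -1],
    [0, 0, 1, 0, -1, 0, 1, -1, 1, 1, -1, 0, -1, 1, 0, 0, 0, -1, -1, -1, 0, 1],
    [0, 0, 0, 0, 0, 0, 0, 0, 1, 0, -1, 0, 0, 0, 0, 1, 0, 0, 0, -1, 1, 0],
    [0, 0, -1, 0, 2, -2, 0, 1, -1, 1, 1, 0, -1, 1, 0, -2, -1, 0, 0, 1, -2, -2],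
    [0, 0, 1, -1, -1, 2, 0, -1, 0, -1, 0, 0, 1, -1, 0, 1, 1, 1, 0, 0, 1, 1],
    [0, 0, 0, 0, 1, -1, 0, 0, 0, 0, 0, 0, 0, 0, 0, 0, 0, -1, 0, 0, 0, 0],
    [0, 0, 0, 1, -2, 1, 0, 0, 1, 0, -1, 0, 1, -1, 0, 0, 0, 0, 0, 0, 1, 1],
    [0, 0, 0, 0, 0, 0, 0, 0, 0, -1, 1, 0, -1, 1, 0, 0, 0, 0, 0, 0, 0, 0],
    [0, 0, -1, 0, 1, -1, 1, 0, -1, 1, 0, 0, 0, 0, 0, 0, 0, 0, 0, 0, -1, -1],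
    [0, 1, 1, -1, 0, 0, -1, 1, 0, 0, 0, 0, 0, 0, 0, 0, 0, 0, 0, 0, 0, 0],
    [0, -2, 0, 1, 0, 0, 0, 0, 0, 0, 0, 0, 0, 0, 0, 0, 0, 0, 0, 0, 0, 0],
    [0, 1, 0, 0, -1, 1, 0, -1, 0, -1, -1, 1, 0, 0, 0, 0, 0, 0, 0, 0, 1, 1],
    [0, 0, 0, 0, 0, 0, 0, 0, 0, 1, 1, -2, 1, 0, 0, 0, 0, 0, 0, 0, 0, 0],
    [0, 0, 0, 0, 0, 0, 0, 0, 0, 0, 0, 1, -1, -1, 1, 0, 0, 0, 0, 0, 0, 0],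
    [0, 0, 0, 0, 0, 0, 0, 0, 0, 0, 0, 0, 0, 1, -2, 1, 0, 0, 0, 0, 0, 0],
    [1, 0, -1, 0, 1, -1, 0, 0, 0, 0, 0, 0, 0, 0, 1, -1, 0, 0, 0, 0, -1, -1],
    [-2, 0, 1, 0, 0, 0, 0, 0, 0, 0, 0, 0, 0, 0, 0, 0, 0, 0, 0, 0, 0, 0],
    [0, 0, -1, -1, 3, -2, 0, 1, -1, 1, 1, 0, -1, 1, 0, -1, 0, 1, 0, 0, -3, -3],
    [0, 0, -1, 0, 1, 0, -1, 1, -2, -1, 2, 0, 1, -1, 0, -1, 0, 1, 2, 2, -1, -1],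
    [0, 0, 2, -1, -6, 10, -3, -2, 1, -4, -1, 0, 4, -4, 0, 4, 6, 4, 0, 0, 6, 6]]

/-- The vectors with the coordinates in `tableOne`. -/
def coordsOne (i : Fin 23) (m : Fin 22) : ℤ := (tableOne.getD i []).getD m 0

theorem gram_coordsOne (i j : Fin 22) :
    latticeK3.form (ofCoords (coordsOne i.castSucc)) (ofCoords (coordsOne j.castSucc)) =
      if hi : (i : ℕ) < 19 then
        if hj : (j : ℕ) < 19 then -CartanMatrix.A 19 ⟨i, hi⟩ ⟨j, hj⟩ else 0
      else if i = j then if i = 21 then 20 else 2 else 0 := by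
  -- With the dual rows precomputed, each entry of the Gram matrix is a plain dot product of two
  -- literal lists. The glue row 22 is left out by `castSucc`.
  have h1 : ∀ i : Fin 22, List.ofFn (coordsOne i.castSucc) = tableOne.getD i [] := by
    decide +kernel
  have h2 : ∀ j : Fin 22, dualCoords (coordsOne j.castSucc) = dualTableOne.getD j [] := by
    decide +kernel
  rw [ofCoords_form, h1, h2]
  revert i j
  decide +kernel

theorem glue_coordsOne : ∀ m : Fin 22, 20 * coordsOne 22 m =
    ∑ i : Fin 19, ((i : ℤ) - 19) * coordsOne (i.castLE (by decide)) m +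
      10 * coordsOne 20 m + 3 * coordsOne 21 m := by
  decide +kernel

/-- Coordinates of the images of the simple roots and of `h` under the second embedding into
`2E₈ ⊕ 3U`, of two generators of the orthogonal complement, and of a glue vector. -/
def tableTwo : List (List ℤ) :=
  [[2, 3, 4, 5, 4, 3, 2, 1, 0, 0, 0, 0, 0, 0, 0, 0, 0, 0, 0, 0, -1, 0],
    [-2, -2, -4, -5, -4, -3, -2, -1, 0, 0, 0, 0, 0, 0, 0, 0, 0, 0, 0, 0, 1, 0],
    [2, 2, 4, 5, 4, 3, 2, 1, 0, 0, 0, 0, 0, 0, 0, 0, 0, 0, 0, 0, 0, -1],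
    [-3, -4, -6, -8, -6, -5, -4, -2, -2, -3, -4, -5, -4, -3, -2, -1, -1, 0, 0, 0, 1, 2],
    [3, 4, 6, 8, 6, 5, 4, 2, 4, 5, 7, 10, 8, 6, 4, 2, 1, -1, 0, 0, -2, -2],
    [-1, -2, -3, -4, -3, -3, -2, -1, -2, -2, -3, -5, -4, -3, -2, -1, 0, 1, 0, 0, 1, 1],
    [0, 0, 0, 0, 0, 1, 0, 0, 0, 0, 0, 0, 0, 0, 0, 0, 0, 0, 0, 0, 0, 0],
    [1, 2, 3, 4, 3, 2, 2, 1, 2, 2, 3, 4, 3, 3, 2, 1, 0, 0, 0, 0, -1, -1],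
    [0, 0, 0, 0, 0, 0, 0, 0, 0, 1, 0, 1, 1, 0, 0, 0, 0, 0, 0, 0, 0, 0],
    [-1, -1, -2, -2, -2, -2, -2, -1, -2, -3, -3, -5, -4, -3, -2, -1, 0, 0, 0, 0, 1, 1],
    [-2, -3, -4, -6, -4, -3, -2, -1, -1, -2, -2, -4, -3, -3, -2, -1, 0, 1, 0, 0, 1, 1],
    [2, 3, 4, 6, 5, 4, 3, 1, 1, 2, 2, 4, 3, 3, 2, 1, 0, -1, 0, 0, -1, -1],
    [1, 1, 2, 2, 1, 1, 1, 1, 2, 3, 4, 6, 5, 4, 2, 1, 0, 0, 0, 0, -1, -1],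
    [-1, -1, -2, -2, -1, -1, -1, 0, -2, -3, -4, -6, -5, -4, -2, -1, 0, 0, 0, 0, 1, 1],
    [1, 1, 2, 2, 1, 1, 1, 0, 2, 3, 4, 6, 5, 4, 3, 1, 0, 0, 0, 0, -1, -1],
    [0, 0, 0, 0, 0, 0, 0, 0, 0, 0, 0, 0, -1, -1, -1, 0, 0, 0, 1, 0, 0, 0],
    [0, 0, 0, 0, 0, 0, 0, 0, 0, 0, 0, 0, 0, 0, 0, 0, 0, 0, -1, 1, 0, 0],
    [0, 0, -1, 0, 0, 0, 0, 0, -2, -4, -5, -7, -4, -3, -2, -1, -1, 0, -1, -2, 1, 1],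
    [0, 0, 1, 0, 0, 0, 0, 0, 2, 4, 5, 7, 5, 4, 3, 2, 1, 0, 1, 1, -1, -1],
    [-3, -4, -6, -8, -6, -5, -4, -2, -3, -4, -5, -9, -7, -6, -4, -2, 1, 2, 0, 0, 2, 2],
    [0, 0, 1, 0, 0, 0, 0, 0, 2, 4, 5, 7, 4, 3, 2, 1, 1, 0, 2, 2, -1, -1],
    [15, 20, 31, 40, 30, 25, 20, 10, 19, 28, 36, 52, 41, 33, 22, 11, 4, 0, 0, 0, -11, -11],
    [4, 5, 9, 11, 8, 7, 6, 3, 7, 11, 14, 20, 15, 12, 8, 4, 2, 0, 1, 1, -4, -4]]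

/-- The products of the rows of `tableTwo` with the standard basis. -/
def dualTableTwo : List (List ℤ) :=
  [[0, -1, -1, 1, 0, 0, 0, 0, 0, 0, 0, 0, 0, 0, 0, 0, 0, 0, 0, 0, 0, -1],
    [0, -1, 1, 0, 0, 0, 0, 0, 0, 0, 0, 0, 0, 0, 0, 0, 0, 0, 0, 0, 0, 1],
    [0, 1, -1, 0, 0, 0, 0, 0, 0, 0, 0, 0, 0, 0, 0, 0, 0, 0, 0, 0, -1, 0],
    [0, 0, 1, 0, -1, 0, 1, 0, 0, 1, 1, -1, 0, 0, 0, 0, 0, -1, 0, 0, 2, 1],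
    [0, 0, -1, 0, 1, 0, -1, 0, -1, 0, 0, 0, 0, 0, 0, 0, -1, 1, 0, 0, -2, -2],
    [-1, 0, 1, 0, -1, 1, 0, 0, 1, -1, -1, 1, 0, 0, 0, 0, 1, 0, 0, 0, 1, 1],
    [0, 0, 0, 0, 1, -2, 1, 0, 0, 0, 0, 0, 0, 0, 0, 0, 0, 0, 0, 0, 0, 0],
    [1, 0, -1, 0, 0, 1, -1, 0, -1, 0, 0, 0, 1, -1, 0, 0, 0, 0, 0, 0, -1, -1],
    [0, 0, 0, 0, 0, 0, 0, 0, 0, -1, 1, 0, -1, 1, 0, 0, 0, 0, 0, 0, 0, 0],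
    [0, 0, 1, -1, 0, 0, 1, 0, 1, 1, -1, 0, 0, 0, 0, 0, 0, 0, 0, 0, 1, 1],
    [0, 0, 0, 1, -1, 0, 0, 0, 0, 0, -1, 1, -1, 1, 0, 0, 1, 0, 0, 0, 1, 1],
    [0, 0, 0, 0, 0, 0, -1, 1, 0, 0, 1, -1, 1, -1, 0, 0, -1, 0, 0, 0, -1, -1],
    [0, 0, -1, 0, 1, 0, 0, -1, 0, 0, 0, 0, 0, -1, 1, 0, 0, 0, 0, 0, -1, -1],
    [0, 0, 1, 0, -1, 0, 1, -1, 0, 0, 0, 0, 0, 1, -1, 0, 0, 0, 0, 0, 1, 1],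
    [0, 0, -1, 0, 1, 0, -1, 1, 0, 0, 0, 0, 0, 0, -1, 1, 0, 0, 0, 0, -1, -1],
    [0, 0, 0, 0, 0, 0, 0, 0, 0, 0, 0, -1, 1, 0, 1, -1, 0, 0, 0, 1, 0, 0],
    [0, 0, 0, 0, 0, 0, 0, 0, 0, 0, 0, 0, 0, 0, 0, 0, 0, 0, 1, -1, 0, 0],
    [-1, 0, 2, -1, 0, 0, 0, 0, -1, 1, 1, 1, -2, 0, 0, 0, 0, -1, -2, -1, 1, 1],
    [1, 0, -2, 1, 0, 0, 0, 0, 1, -1, -1, 0, 1, 0, 0, -1, 0, 1, 1, 1, -1, -1],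
    [0, 0, 1, 0, -1, 0, 1, 0, 1, -1, -2, 2, -1, 1, 0, 0, 2, 1, 0, 0, 2, 2],
    [1, 0, -2, 1, 0, 0, 0, 0, 1, -1, -1, -1, 2, 0, 0, 0, 0, 1, 2, 2, -1, -1],
    [1, 0, -7, 1, 5, 0, -5, 0, -2, -4, -1, 1, 3, -3, 0, 0, 0, 4, 0, 0, -11, -11]]

/-- The vectors with the coordinates in `tableTwo`. -/
def coordsTwo (i : Fin 23) (m : Fin 22) : ℤ := (tableTwo.getD i []).getD m 0

theorem gram_coordsTwo (i j : Fin 22) :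
    latticeK3.form (ofCoords (coordsTwo i.castSucc)) (ofCoords (coordsTwo j.castSucc)) =
      if hi : (i : ℕ) < 19 then
        if hj : (j : ℕ) < 19 then -CartanMatrix.A 19 ⟨i, hi⟩ ⟨j, hj⟩ else 0
      else if i = j then if i = 21 then 20 else 2 else 0 := by
  have h1 : ∀ i : Fin 22, List.ofFn (coordsTwo i.castSucc) = tableTwo.getD i [] := by
    decide +kernel
  have h2 : ∀ j : Fin 22, dualCoords (coordsTwo j.castSucc) = dualTableTwo.getD j [] := by
    decide +kernel
  rw [ofCoords_form, h1, h2]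
  revert i j
  decide +kernel

theorem glue_coordsTwo : ∀ m : Fin 22, 20 * coordsTwo 22 m =
    ∑ i : Fin 19, ((i : ℤ) - 19) * coordsTwo (i.castLE (by decide)) m +
      10 * coordsTwo 20 m + 7 * coordsTwo 21 m := by
  decide +kernel

/-! ### Uniqueness of the configuration: S has no proper even extension of finite index -/

/-- A lattice with trivial radical. -/
def IsNondegenerate (L : EvenLattice) : Prop := ∀ x : L, (∀ y, L.form x y = 0) → x = 0

/-- By nondegeneracy of the targets, both kernels are the radical of one and the same pulled back
form on V, so both lattices are the same quotient of V. -/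
theorem exists_isometry_of_surjective {V : Type} [AddCommGroup V] {L M : EvenLattice}
    (hL : L.IsNondegenerate) (hM : M.IsNondegenerate) (F : V →ₗ[ℤ] L) (G : V →ₗ[ℤ] M)
    (hF : Function.Surjective F) (hG : Function.Surjective G)
    (h : ∀ a b, L.form (F a) (F b) = M.form (G a) (G b)) :
    ∃ f : Isometry L M, ∀ a, f (F a) = G a := by
  have hker : LinearMap.ker F = LinearMap.ker G := by
    ext a
    rw [LinearMap.mem_ker, LinearMap.mem_ker]
    constructor
    · intro ha
      refine hM _ fun y => ?_
      obtain ⟨b, rfl⟩ := hG y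
      rw [← h, ha]; simp
    · intro ha
      refine hL _ fun y => ?_
      obtain ⟨b, rfl⟩ := hF y
      rw [h, ha]; simp
  let e : L ≃ₗ[ℤ] M := (F.quotKerEquivOfSurjective hF).symm ≪≫ₗ
    Submodule.quotEquivOfEq _ _ hker ≪≫ₗ G.quotKerEquivOfSurjective hG
  have he : ∀ a, e (F a) = G a := fun a => by
    have h1 : (F.quotKerEquivOfSurjective hF).symm (F a) = Submodule.Quotient.mk a := by
      rw [LinearEquiv.symm_apply_eq]; rfl
    simp only [e, LinearEquiv.trans_apply, h1, Submodule.quotEquivOfEq_mk]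
    rfl
  refine ⟨⟨e, fun x y => ?_⟩, he⟩
  obtain ⟨a, rfl⟩ := hF x
  obtain ⟨b, rfl⟩ := hF y
  rw [he, he, h]

/-- The equation is 40m = 10l² - 19k², which yields in turn 10 ∣ k, 2 ∣ l and 20 ∣ k. It expresses
that the discriminant form of S has no nonzero isotropic element. -/
theorem exists_eq_mul_of_isotropic {k l m : ℤ}
    (hsq : 20 * (20 * (m + m)) = k * k * (-380) + 10 * l * (10 * l) * 2) :
    ∃ k', k = 20 * k' ∧ ∃ l', l = 2 * l' := by
  have hk10 : k * k % 10 = 0 := by ring_nf at hsq ⊢; omega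
  have hk1 : k % 10 = 0 := by
    have h5 : k % 10 = 0 ∨ k % 10 = 1 ∨ k % 10 = 2 ∨ k % 10 = 3 ∨ k % 10 = 4 ∨ k % 10 = 5 ∨
      k % 10 = 6 ∨ k % 10 = 7 ∨ k % 10 = 8 ∨ k % 10 = 9 := by omega
    rw [Int.mul_emod] at hk10
    rcases h5 with h | h | h | h | h | h | h | h | h | h <;> rw [h] at hk10 <;> omega
  obtain ⟨p, rfl⟩ : ∃ p, k = 10 * p := ⟨k / 10, by omega⟩
  have hl1 : l * l % 2 = 0 := by ring_nf at hsq ⊢; omega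
  have hl2 : l % 2 = 0 := by
    rcases Int.emod_two_eq_zero_or_one l with h | h
    · exact h
    · rw [Int.mul_emod, h] at hl1; omega
  obtain ⟨q, rfl⟩ : ∃ q, l = 2 * q := ⟨l / 2, by omega⟩
  have hp1 : p * p % 2 = 0 := by ring_nf at hsq ⊢; omega
  have hp2 : p % 2 = 0 := by
    rcases Int.emod_two_eq_zero_or_one p with h | h
    · exact h
    · rw [Int.mul_emod, h] at hp1; omega
  exact ⟨p / 2, by omega, q, rfl⟩

theorem smul_injective_of_ne_zero (L : EvenLattice) {n : ℤ} (hn : n ≠ 0) {x y : L}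
    (h : n • x = n • y) : x = y := smul_right_injective (L : Type) hn h

/-- The identity isometry. -/
def Isometry.refl (L : EvenLattice) : Isometry L L := ⟨LinearEquiv.refl ℤ L, fun _ _ => rfl⟩

theorem refl_mem_admissible {Sg : EvenLattice} (σ : Set Sg) :
    Isometry.refl (polarized Sg) ∈ admissible Sg σ :=
  ⟨rfl, Set.image_id _⟩

theorem areIsomorphic_of_emb {Sg : EvenLattice} (σ : Set Sg) {E F : Extension (polarized Sg)}
    (f : Isometry E.L F.L) (hf : ∀ x, f (E.emb x) = F.emb x) : AreIsomorphic σ E F :=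
  ⟨f, Isometry.refl _, refl_mem_admissible σ, hf⟩

theorem polarized_form_vecH (x : polarized (latticeA 19)) :
    (polarized (latticeA 19)).form x (vecH _) = 2 * x.2 0 := by
  rw [polarized_form_apply]
  change (latticeA 19).form x.1 0 + 2 * (x.2 0 * 1) = _
  rw [map_zero, zero_add, mul_one]

theorem polarized_form_inl (x : polarized (latticeA 19)) (a : latticeA 19) :
    (polarized (latticeA 19)).form x (inclSigma _ a) = (latticeA 19).form x.1 a := by
  rw [polarized_form_apply]
  change _ + 2 * (x.2 0 * 0) = _
  rw [mul_zero, mul_zero, add_zero]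
  rfl

theorem polarized_eq (x : polarized (latticeA 19)) :
    x = ∑ i, x.1 i • inclSigma _ (simpleRoot i) + x.2 0 • vecH (latticeA 19) := by
  have h1 : ∑ i, x.1 i • inclSigma (latticeA 19) (simpleRoot i) = inclSigma _ x.1 := by
    conv_rhs => rw [sum_smul_simpleRoot x.1]
    rw [map_sum]
    exact Finset.sum_congr rfl fun i _ => (map_smul _ _ _).symm
  rw [h1]
  refine Prod.ext ?_ ?_
  · change x.1 = x.1 + x.2 0 • (0 : latticeA 19)
    rw [smul_zero, add_zero]
  · change x.2 = 0 + x.2 0 • (fun _ => 1 : Fin 1 → ℤ)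
    ext i
    rw [Subsingleton.elim i 0]
    change x.2 0 = 0 + x.2 0 * 1
    ring

namespace Extension

variable (E : Extension (polarized (latticeA 19)))

/-- The image of a simple root. -/
def root (i : Fin 19) : E.L := E.emb (inclSigma _ (simpleRoot i))

/-- The image of `h`. -/
def polarization : E.L := E.emb (vecH _)

/-- The image of `20 ω`. -/
def weight : E.L := E.emb (inclSigma _ weightVec)

/-- Orthogonality to the image of `S`. -/
def IsPerp (t : E.L) : Prop := ∀ s, E.L.form t (E.emb s) = 0

variable {E}

theorem form_emb_left_of_isPerp {t : E.L} (ht : E.IsPerp t) (s) : E.L.form (E.emb s) t = 0 := by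
  rw [E.L.symm, ht]

theorem isPerp_of_root {t : E.L} (h : ∀ i, E.L.form t (E.root i) = 0)
    (hh : E.L.form t E.polarization = 0) : E.IsPerp t := fun s => by
  rw [polarized_eq s, map_add, map_add, map_sum, map_sum, map_smul, map_smul]
  have : E.L.form t (E.emb (vecH _)) = 0 := hh
  rw [this, smul_zero, add_zero]
  refine Finset.sum_eq_zero fun i _ => ?_
  have : E.L.form t (E.emb (inclSigma _ (simpleRoot i))) = 0 := h i
  rw [map_smul, map_smul, this, smul_zero]

theorem eq_zero_of_isPerp_emb {s} (h : E.IsPerp (E.emb s)) : s = 0 :=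
  polarized_eq_zero_of_form fun y => by rw [← E.form_emb]; exact h y

theorem form_weight_root (i : Fin 19) :
    E.L.form E.weight (E.root i) = if i = 0 then 20 else 0 := by
  rw [weight, root, E.form_emb, polarized_form_inl]
  exact form_weightVec_simpleRoot i

theorem form_weight_polarization : E.L.form E.weight E.polarization = 0 := by
  rw [weight, polarization, E.form_emb, polarized_form_vecH]
  rfl

theorem form_weight_weight : E.L.form E.weight E.weight = -380 := by
  rw [weight, E.form_emb, polarized_form_inl]
  exact form_weightVec_self

theorem form_polarization_self : E.L.form E.polarization E.polarization = 2 := by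
  rw [polarization, E.form_emb, polarized_form_vecH]
  rfl

theorem form_polarization_root (i : Fin 19) : E.L.form E.polarization (E.root i) = 0 := by
  rw [root, polarization, E.form_emb, polarized_form_inl]
  change (latticeA 19).form 0 _ = 0
  rw [map_zero, LinearMap.zero_apply]

theorem form_inl_polarization (a : latticeA 19) :
    E.L.form (E.emb (inclSigma _ a)) E.polarization = 0 := by
  rw [polarization, E.form_emb, polarized_form_vecH]
  rfl

/-- Modulo `A₁₉`, every vector is orthogonal to all simple roots but the first one. -/
theorem exists_sub_emb (x : E.L) : ∃ a : latticeA 19,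
    ∀ i, i ≠ 0 → E.L.form (x - E.emb (inclSigma _ a)) (E.root i) = 0 := by
  obtain ⟨a, ha⟩ := exists_form_simpleRoot_eq fun i => E.L.form x (E.root i)
  refine ⟨a, fun i hi => ?_⟩
  have : E.L.form (E.emb (inclSigma _ a)) (E.root i) = E.L.form x (E.root i) := by
    rw [← ha i hi, root, E.form_emb, polarized_form_inl]
    rfl
  rw [map_sub, LinearMap.sub_apply, this, sub_self]

theorem eq_zero_of_mem_hull_of_isPerp {x : E.L} (hx : x ∈ E.hull) (h : E.IsPerp x) : x = 0 := by
  obtain ⟨n, hn, s, hs⟩ := hx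
  have : s = 0 := eq_zero_of_isPerp_emb (E := E) fun y => by
    rw [hs, map_smul, LinearMap.smul_apply, h, smul_zero]
  rw [this, map_zero] at hs
  exact smul_injective_of_ne_zero _ hn (by rw [← hs, smul_zero])

/-- The projection of y to S ⊗ ℚ is (y·e₀) ω + (y·h) h/2, where e₀ is the first simple root; the
factor 20 clears the denominators. -/
theorem isPerp_twenty_smul_sub {y : E.L} (hy : ∀ i, i ≠ 0 → E.L.form y (E.root i) = 0) :
    E.IsPerp ((20 : ℤ) • y - (E.L.form y (E.root 0) • E.weight +
      (10 * E.L.form y E.polarization) • E.polarization)) := by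
  refine isPerp_of_root (fun i => ?_) ?_
  · simp only [map_sub, map_add, map_smul, LinearMap.sub_apply, LinearMap.add_apply,
      LinearMap.smul_apply, form_weight_root, form_polarization_root, smul_eq_mul]
    by_cases hi : i = 0
    · subst hi; rw [if_pos rfl]; ring
    · rw [if_neg hi, hy i hi]; ring
  · simp only [map_sub, map_add, map_smul, LinearMap.sub_apply, LinearMap.add_apply,
      LinearMap.smul_apply, form_weight_polarization, form_polarization_self, smul_eq_mul]
    ring

/-- Modulo A₁₉, a vector of the hull equals kω + lh/2 with integers k and l; its even square puts it
into S by `exists_eq_mul_of_isotropic`. -/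
theorem mem_range_of_mem_hull {x : E.L} (hx : x ∈ E.hull) : x ∈ LinearMap.range E.emb := by
  obtain ⟨a, ha⟩ := exists_sub_emb x
  set y := x - E.emb (inclSigma _ a) with hy
  have hyh : y ∈ E.hull := sub_mem hx (E.emb_mem_hull _)
  set k := E.L.form y (E.root 0) with hk
  set l := E.L.form y E.polarization with hl
  have h0 : (20 : ℤ) • y - (k • E.weight + (10 * l) • E.polarization) = 0 :=
    eq_zero_of_mem_hull_of_isPerp (sub_mem (Submodule.smul_mem _ _ hyh)
      (add_mem (Submodule.smul_mem _ _ (E.emb_mem_hull _))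
        (Submodule.smul_mem _ _ (E.emb_mem_hull _)))) (isPerp_twenty_smul_sub ha)
  rw [sub_eq_zero] at h0
  have hsq : 20 * (20 * E.L.form y y) = k * k * (-380) + 10 * l * (10 * l) * 2 := by
    have h1 : E.L.form ((20 : ℤ) • y) ((20 : ℤ) • y) = 20 * (20 * E.L.form y y) := by simp
    rw [← h1, h0]
    simp only [map_add, map_smul, LinearMap.add_apply, LinearMap.smul_apply,
      form_weight_weight, form_polarization_self, form_weight_polarization,
      E.L.symm E.polarization E.weight, smul_eq_mul]
    ring
  obtain ⟨m, hm⟩ := E.L.even y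
  rw [hm] at hsq
  obtain ⟨k', hk', l', hl'⟩ := exists_eq_mul_of_isotropic hsq
  have hyr : y = k' • E.weight + l' • E.polarization := by
    refine smul_injective_of_ne_zero _ (n := 20) (by norm_num) ?_
    rw [h0, hk', hl', smul_add, smul_smul, smul_smul]
    congr 2; ring
  have hx' : x = y + E.emb (inclSigma _ a) := by rw [hy]; abel
  rw [hx', hyr]
  exact add_mem (add_mem (Submodule.smul_mem _ _ ⟨_, rfl⟩) (Submodule.smul_mem _ _ ⟨_, rfl⟩))
    ⟨_, rfl⟩

theorem hullExtension_emb_surjective : Function.Surjective E.hullExtension.emb := by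
  rintro ⟨x, hx⟩
  obtain ⟨s, hs⟩ := mem_range_of_mem_hull hx
  exact ⟨s, Subtype.ext hs⟩

theorem isNondegenerate_of_surjective (h : Function.Surjective E.emb) :
    E.L.IsNondegenerate := fun x hx => by
  obtain ⟨s, rfl⟩ := h x
  rw [eq_zero_of_isPerp_emb fun y => hx _, map_zero]

/-- The index annihilates the quotient, so every vector lies in the hull of S, which is S. -/
theorem _root_.EvenLattice.IsConfiguration.emb_surjective (h : IsConfiguration E) :
    Function.Surjective E.emb := fun x => by
  have := h.finiteIndex
  refine mem_range_of_mem_hull ⟨((LinearMap.range E.emb).toAddSubgroup.index : ℤ),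
    Int.natCast_ne_zero.2 this.index_ne_zero, ?_⟩
  rw [natCast_zsmul]
  exact AddSubgroup.nsmul_index_mem (LinearMap.range E.emb).toAddSubgroup x

/-- Inside S itself the complement of h is A₁₉, which is generated by its simple roots, and twice a
vector has even coefficient at h, unlike r + h. -/
theorem isConfiguration_of_surjective (h : Function.Surjective E.emb) : IsConfiguration E where
  finiteIndex := by
    rw [LinearMap.range_eq_top.2 h]
    change (⊤ : AddSubgroup E.L).FiniteIndex
    infer_instance
  roots := by
    apply le_antisymm
    · rw [Submodule.span_le]
      rintro r ⟨hr, -⟩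
      obtain ⟨s, rfl⟩ := h r
      rw [E.form_emb, (polarized _).symm, polarized_form_vecH] at hr
      refine ⟨s.1, congrArg E.emb (Prod.ext rfl ?_)⟩
      ext i
      rw [Subsingleton.elim i 0]
      change 0 = s.2 0
      omega
    · rintro _ ⟨a, rfl⟩
      rw [LinearMap.comp_apply, sum_smul_simpleRoot a, map_sum, map_sum]
      refine sum_mem fun i _ => ?_
      rw [map_smul, map_smul]
      refine Submodule.smul_mem _ _ (Submodule.subset_span ⟨form_polarization_root i, ?_⟩)
      rw [E.form_emb, polarized_form_inl]
      refine (latticeA_form_simpleRoot 19 i i).trans ?_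
      simp [CartanMatrix.A]
  noHalf := by
    rintro ⟨r, -, x, hx⟩
    obtain ⟨s, rfl⟩ := h x
    rw [← map_smul, ← map_add] at hx
    have h2 := congrFun (congrArg Prod.snd (E.injective hx)) 0
    change 2 * s.2 0 = 0 + 1 at h2
    omega

theorem areIsomorphic_of_surjective {F : Extension (polarized (latticeA 19))}
    (hE : Function.Surjective E.emb) (hF : Function.Surjective F.emb)
    (σ : Set (latticeA 19)) : AreIsomorphic σ E F := by
  obtain ⟨f, hf⟩ := exists_isometry_of_surjective (isNondegenerate_of_surjective hE)
    (isNondegenerate_of_surjective hF) E.emb F.emb hE hF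
    fun a b => by rw [E.form_emb, F.form_emb]
  exact areIsomorphic_of_emb σ f hf

/-- The trivial extension. -/
def refl (S : EvenLattice) : Extension S := ⟨S, LinearMap.id, fun _ _ h => h, fun _ _ => rfl⟩

end Extension

/-! ### Unimodular lattices -/

/-- Every functional is the product with a vector. -/
def IsUnimodular (L : EvenLattice) : Prop := ∀ φ : L →ₗ[ℤ] ℤ, ∃ z, ∀ w, L.form z w = φ w

theorem IsUnimodular.isNondegenerate {L : EvenLattice} (h : L.IsUnimodular) :
    L.IsNondegenerate := fun x hx =>
  (Module.forall_dual_apply_eq_zero_iff ℤ x).1 fun φ => by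
    obtain ⟨z, hz⟩ := h φ
    rw [← hz, L.symm, hx]

theorem IsUnimodular.of_isometry {L M : EvenLattice} (f : Isometry L M) (h : M.IsUnimodular) :
    L.IsUnimodular := fun φ => by
  obtain ⟨z, hz⟩ := h (φ ∘ₗ (f.toEquiv.symm : M →ₗ[ℤ] L))
  refine ⟨f.toEquiv.symm z, fun w => ?_⟩
  rw [← f.form_map, LinearEquiv.apply_symm_apply, hz]
  simp

theorem IsUnimodular.directSum {L M : EvenLattice} (hL : L.IsUnimodular) (hM : M.IsUnimodular) :
    (L ⊞ M).IsUnimodular := fun φ => by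
  obtain ⟨z, hz⟩ := hL (φ ∘ₗ LinearMap.inl ℤ L M)
  obtain ⟨z', hz'⟩ := hM (φ ∘ₗ LinearMap.inr ℤ L M)
  refine ⟨(z, z'), fun w => ?_⟩
  change L.form z w.1 + M.form z' w.2 = _
  rw [hz, hz', LinearMap.comp_apply, LinearMap.comp_apply, ← map_add]
  simp

theorem isUnimodular_ofGram {ι : Type} [Fintype ι] [DecidableEq ι] (G : Matrix ι ι ℤ)
    (hs : G.IsSymm) (hd : ∀ i, Even (G i i)) (hG : IsUnit G.det) :
    (ofGram G hs hd).IsUnimodular := fun φ => by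
  refine ⟨Matrix.vecMul (fun i => φ (Pi.single i 1 : ι → ℤ)) G⁻¹, fun w => ?_⟩
  have h1 : (ofGram G hs hd).form (Matrix.vecMul (fun i => φ (Pi.single i 1 : ι → ℤ)) G⁻¹) w =
      dotProduct (Matrix.vecMul (fun i => φ (Pi.single i 1 : ι → ℤ)) G⁻¹) (G.mulVec w) :=
    Matrix.toBilin'_apply' _ _ _
  rw [h1, Matrix.dotProduct_mulVec, Matrix.vecMul_vecMul, Matrix.nonsing_inv_mul _ hG,
    Matrix.vecMul_one]
  have h2 : w = ∑ i, w i • (Pi.single i 1 : ι → ℤ) := by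
    ext j; simp [Finset.sum_apply, Pi.single_apply]
  conv_rhs => rw [h2, map_sum]
  refine Finset.sum_congr rfl fun i _ => ?_
  rw [map_smul, smul_eq_mul, mul_comm]

theorem isUnimodular_latticeK3 : latticeK3.IsUnimodular := by
  have hE : latticeE8.IsUnimodular := isUnimodular_ofGram _ _ _ (by
    rw [Matrix.det_neg, CartanMatrix.E₈_det]; simp)
  have hU : hyperbolicPlane.IsUnimodular := isUnimodular_ofGram _ _ _ (by
    rw [Matrix.det_fin_two]; simp)
  exact hE.directSum (hE.directSum (hU.directSum (hU.directSum hU)))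

theorem finrank_latticeK3 : Module.finrank ℤ latticeK3 = 22 := by
  change Module.finrank ℤ ((Fin 8 → ℤ) × (Fin 8 → ℤ) × (Fin 2 → ℤ) × (Fin 2 → ℤ) ×
    (Fin 2 → ℤ)) = 22
  simp [Module.finrank_prod]

/-- Each of the three hyperbolic planes contributes the sum of its two isotropic basis vectors. -/
theorem exists_orthogonal_latticeK3 :
    ∃ p : Fin 3 → latticeK3, ∀ i j, latticeK3.form (p i) (p j) = if i = j then 2 else 0 := by
  refine ⟨fun i => ofCoords fun m =>
    if (m : ℕ) = 16 + 2 * i ∨ (m : ℕ) = 17 + 2 * i then 1 else 0, fun i j => ?_⟩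
  rw [ofCoords_form]
  revert i j
  decide +kernel

/-- Functionals on a saturated subgroup of a unimodular lattice. -/
theorem IsUnimodular.exists_form_eq {L : EvenLattice} (h : L.IsUnimodular) (P : Submodule ℤ L)
    (hP : ∀ (n : ℤ) (x : L), n ≠ 0 → n • x ∈ P → x ∈ P) (φ : P →ₗ[ℤ] ℤ) :
    ∃ z, ∀ w : P, L.form z w = φ w := by
  -- Saturation makes L/P torsion free, hence free, so P is a direct summand and φ extends to L by
  -- the projection onto P.
  have : Module.IsTorsionFree ℤ (L ⧸ P) := ⟨fun r hr x y hxy => by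
    obtain ⟨x, rfl⟩ := P.mkQ_surjective x
    obtain ⟨y, rfl⟩ := P.mkQ_surjective y
    have h1 : r • P.mkQ x = r • P.mkQ y := hxy
    rw [← map_smul, ← map_smul, ← sub_eq_zero, ← map_sub, ← smul_sub, Submodule.mkQ_apply,
      Submodule.Quotient.mk_eq_zero] at h1
    rw [← sub_eq_zero, ← map_sub, Submodule.mkQ_apply, Submodule.Quotient.mk_eq_zero]
    exact hP r _ (by rintro rfl; exact not_isRegular_zero hr) h1⟩
  have : Module.Free ℤ (L ⧸ P) := Module.free_of_finite_type_torsion_free'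
  obtain ⟨g, hg⟩ := Module.projective_lifting_property P.mkQ LinearMap.id P.mkQ_surjective
  have hmem : ∀ x, (LinearMap.id - g ∘ₗ P.mkQ : L →ₗ[ℤ] L) x ∈ P := fun x => by
    rw [← Submodule.Quotient.mk_eq_zero, ← Submodule.mkQ_apply, LinearMap.sub_apply, map_sub,
      sub_eq_zero]
    exact (LinearMap.congr_fun hg (P.mkQ x)).symm
  obtain ⟨z, hz⟩ := h (φ ∘ₗ (LinearMap.id - g ∘ₗ P.mkQ : L →ₗ[ℤ] L).codRestrict P hmem)
  refine ⟨z, fun w => (hz w).trans (congrArg φ (Subtype.ext ?_))⟩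
  have : P.mkQ (w : L) = 0 := by rw [Submodule.mkQ_apply, Submodule.Quotient.mk_eq_zero]; exact w.2
  simp [this]

/-! ### The complement T of S: rank and definiteness -/

namespace Extension

variable {E : Extension (polarized (latticeA 19))}

theorem mem_orthogonal_iff_isPerp {t : E.L} : t ∈ E.L.form.orthogonal E.hull ↔ E.IsPerp t := by
  constructor
  · intro h s
    rw [E.L.symm]
    exact h _ (E.emb_mem_hull s)
  · intro h x hx
    obtain ⟨s, rfl⟩ := mem_range_of_mem_hull hx
    exact form_emb_left_of_isPerp h s

theorem IsPerp.of_smul {n : ℤ} (hn : n ≠ 0) {t : E.L} (h : E.IsPerp (n • t)) : E.IsPerp t :=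
  fun s => by
    have := h s
    rw [map_smul, LinearMap.smul_apply, smul_eq_mul] at this
    exact (mul_eq_zero.1 this).resolve_left hn

theorem IsPerp.add {t u : E.L} (ht : E.IsPerp t) (hu : E.IsPerp u) : E.IsPerp (t + u) :=
  fun s => by rw [map_add, LinearMap.add_apply, ht, hu, add_zero]

theorem IsPerp.smul (n : ℤ) {t : E.L} (ht : E.IsPerp t) : E.IsPerp (n • t) :=
  fun s => by rw [map_smul, LinearMap.smul_apply, ht, smul_zero]

theorem IsPerp.sub {t u : E.L} (ht : E.IsPerp t) (hu : E.IsPerp u) : E.IsPerp (t - u) :=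
  fun s => by rw [map_sub, LinearMap.sub_apply, ht, hu, sub_zero]

theorem exists_isPerp_twenty_smul_sub (x : E.L) : ∃ s, E.IsPerp ((20 : ℤ) • x - E.emb s) := by
  obtain ⟨a, ha⟩ := exists_sub_emb x
  refine ⟨(20 : ℤ) • inclSigma _ a + (E.L.form (x - E.emb (inclSigma _ a)) (E.root 0) •
    inclSigma _ weightVec + (10 * E.L.form (x - E.emb (inclSigma _ a)) E.polarization) •
    vecH _), ?_⟩
  have := isPerp_twenty_smul_sub ha
  rw [smul_sub] at this
  rw [map_add, map_add, map_smul, map_smul, map_smul, ← sub_sub]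
  exact this

/-- The sum T ⊕ S is embedded in L and contains 20L, so the ranks agree. -/
theorem finrank_perp_add : Module.finrank ℤ E.perp + 20 = Module.finrank ℤ E.L := by
  have hS : Module.finrank ℤ (polarized (latticeA 19)) = 20 := by
    change Module.finrank ℤ ((Fin 19 → ℤ) × (Fin 1 → ℤ)) = 20
    simp [Module.finrank_prod]
  rw [← hS, ← Module.finrank_prod]
  let F : (E.perp × polarized (latticeA 19)) →ₗ[ℤ] E.L :=
    (E.L.form.orthogonal E.hull).subtype.coprod E.emb
  have hF : Function.Injective F := (injective_iff_map_eq_zero _).2 fun x hx => by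
    have h1 : x.1.1 + E.emb x.2 = 0 := hx
    have h2 : x.2 = 0 := eq_zero_of_isPerp_emb (E := E) fun y => by
      have := mem_orthogonal_iff_isPerp.1 x.1.2 y
      rw [eq_neg_of_add_eq_zero_left h1, map_neg, LinearMap.neg_apply, neg_eq_zero] at this
      exact this
    rw [h2, map_zero, add_zero] at h1
    exact Prod.ext (Subtype.ext h1) h2
  apply le_antisymm (LinearMap.finrank_le_finrank_of_injective hF)
  have hR : ∀ x : E.L, ((20 : ℤ) • LinearMap.id : E.L →ₗ[ℤ] E.L) x ∈ LinearMap.range F := by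
    intro x
    obtain ⟨s, hs⟩ := exists_isPerp_twenty_smul_sub x
    refine ⟨(⟨_, mem_orthogonal_iff_isPerp.2 hs⟩, s), ?_⟩
    change (20 : ℤ) • x - E.emb s + E.emb s = (20 : ℤ) • x
    abel
  have h3 : Function.Injective (((20 : ℤ) • LinearMap.id : E.L →ₗ[ℤ] E.L).codRestrict _ hR) :=
    fun x y hxy => smul_injective_of_ne_zero _ (n := 20) (by norm_num) (congrArg Subtype.val hxy)
  exact (LinearMap.finrank_le_finrank_of_injective h3).trans_eq
    (LinearMap.finrank_range_of_inj hF)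

/-- If t² ≤ 0, then A₁₉ + ℤt is negative semidefinite and meets the span of three orthogonal
positive vectors only in 0. This gives 19 + 1 + 3 = 23 independent vectors in a lattice of rank 22.
-/
theorem form_self_pos_of_isPerp (hK : E.L.IsIsomorphic latticeK3) {t : E.L} (ht : E.IsPerp t)
    (h0 : t ≠ 0) : 0 < E.L.form t t := by
  obtain ⟨f⟩ := hK
  obtain ⟨p', hp'⟩ := exists_orthogonal_latticeK3
  let p : Fin 3 → E.L := fun i => f.toEquiv.symm (p' i)
  have hp : ∀ i j, E.L.form (p i) (p j) = if i = j then 2 else 0 := fun i j => by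
    rw [← hp', ← f.form_map]; simp [p]
  by_contra hneg
  let F : (latticeA 19 × ℤ × (Fin 3 → ℤ)) →ₗ[ℤ] E.L :=
    (E.emb ∘ₗ inclSigma _).coprod
      ((LinearMap.toSpanSingleton ℤ E.L t).coprod (Fintype.linearCombination ℤ p))
  have hF : Function.Injective F := (injective_iff_map_eq_zero _).2 fun x hx => by
    obtain ⟨a, c, d⟩ := x
    have h1 : E.emb (inclSigma _ a) + (c • t + ∑ i, d i • p i) = 0 := hx
    rw [← add_assoc] at h1
    have h2 := eq_neg_of_add_eq_zero_left h1
    have h3 : E.L.form (E.emb (inclSigma _ a) + c • t) (E.emb (inclSigma _ a) + c • t) =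
        (latticeA 19).form a a + c * c * E.L.form t t := by
      have h4 : E.L.form (E.emb (inclSigma _ a)) (E.emb (inclSigma _ a)) =
          (latticeA 19).form a a := (E.form_emb _ _).trans (polarized_form_inl _ a)
      rw [← h4]
      simp only [map_add, map_smul, LinearMap.add_apply, LinearMap.smul_apply, ht _,
        form_emb_left_of_isPerp ht, smul_eq_mul]
      ring
    have h4 : E.L.form (∑ i, d i • p i) (∑ i, d i • p i) = ∑ i, 2 * (d i * d i) := by
      rw [form_sum_smul_left]
      refine Finset.sum_congr rfl fun i _ => ?_
      rw [form_sum_smul_right]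
      simp only [hp]
      simp; ring
    rw [h2, map_neg, map_neg, LinearMap.neg_apply, neg_neg, h4] at h3
    have h5 := form_self_nonpos a
    have h6 : c * c * E.L.form t t ≤ 0 := mul_nonpos_of_nonneg_of_nonpos (mul_self_nonneg c)
      (not_lt.1 hneg)
    have h7 : ∀ i ∈ Finset.univ, 0 ≤ 2 * (d i * d i) := fun i _ =>
      mul_nonneg zero_le_two (mul_self_nonneg _)
    have h8 : ∑ i, 2 * (d i * d i) = 0 := le_antisymm (by linarith) (Finset.sum_nonneg h7)
    have hd : d = 0 := funext fun i => by
      have := (Finset.sum_eq_zero_iff_of_nonneg h7).1 h8 i (Finset.mem_univ i)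
      simpa using this
    have ha : a = 0 := eq_zero_of_form_self_eq_zero (le_antisymm h5 (by linarith))
    rw [hd, ha] at h1
    have h9 : c • t = 0 := by simpa using h1
    have hc : c = 0 := by
      by_contra hc
      exact h0 (smul_injective_of_ne_zero _ hc (by rw [h9, smul_zero]))
    rw [ha, hc, hd]; rfl
  have h1 := LinearMap.finrank_le_finrank_of_injective hF
  rw [f.toEquiv.finrank_eq, finrank_latticeK3] at h1
  have h2 : Module.finrank ℤ (latticeA 19 × ℤ × (Fin 3 → ℤ)) = 23 := by
    change Module.finrank ℤ ((Fin 19 → ℤ) × ℤ × (Fin 3 → ℤ)) = 23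
    simp [Module.finrank_prod]
  omega

/-- The T-component of 20x is orthogonal to x and to S, so its square is zero and it vanishes by
definiteness; primitivity of S does the rest. -/
theorem mem_range_of_forall_isPerp (hK : E.L.IsIsomorphic latticeK3) {x : E.L}
    (hx : ∀ t, E.IsPerp t → E.L.form x t = 0) : x ∈ LinearMap.range E.emb := by
  obtain ⟨s, hs⟩ := exists_isPerp_twenty_smul_sub x
  have h1 : (20 : ℤ) • x - E.emb s = 0 := by
    by_contra h0
    have h2 := form_self_pos_of_isPerp hK hs h0
    have h3 : E.L.form ((20 : ℤ) • x - E.emb s) ((20 : ℤ) • x - E.emb s) =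
        20 * E.L.form x ((20 : ℤ) • x - E.emb s) -
          E.L.form (E.emb s) ((20 : ℤ) • x - E.emb s) := by
      rw [map_sub E.L.form, LinearMap.sub_apply]
      simp
    rw [h3, hx _ hs, form_emb_left_of_isPerp hs] at h2
    omega
  exact mem_range_of_mem_hull ⟨20, by norm_num, s, (sub_eq_zero.1 h1).symm⟩

end Extension

/-! ### The discriminant group of S and the determinant of T -/

namespace Extension

variable {E : Extension (polarized (latticeA 19))}

theorem form_weight_right (x : E.L) :
    E.L.form x E.weight = ∑ i, weightVec i * E.L.form x (E.root i) := by
  have h1 : E.weight = ∑ i, weightVec i • E.root i := by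
    rw [weight]
    conv_lhs => rw [sum_smul_simpleRoot weightVec]
    rw [map_sum, map_sum]
    exact Finset.sum_congr rfl fun i _ => by rw [map_smul, map_smul]; rfl
  rw [h1, form_sum_smul_right]

theorem form_weight_right_of_root {x : E.L} (hx : ∀ i, i ≠ 0 → E.L.form x (E.root i) = 0) :
    E.L.form x E.weight = -19 * E.L.form x (E.root 0) := by
  rw [form_weight_right, Finset.sum_eq_single 0 (fun i _ hi => by rw [hx i hi, mul_zero]) (by simp),
    weightVec_zero]

theorem form_emb_weight (s) : E.L.form (E.emb s) E.weight = 20 * s.1 0 := by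
  rw [weight, E.form_emb, polarized_form_inl, EvenLattice.symm]
  exact form_weightVec _

theorem form_emb_polarization (s) : E.L.form (E.emb s) E.polarization = 2 * s.2 0 := by
  rw [polarization, E.form_emb, polarized_form_vecH]

theorem IsPerp.form_weight {t : E.L} (ht : E.IsPerp t) : E.L.form t E.weight = 0 := ht _

theorem IsPerp.form_polarization {t : E.L} (ht : E.IsPerp t) :
    E.L.form t E.polarization = 0 := ht _

/-- Extension of functionals from `S`. -/
theorem exists_form_emb_eq (hL : E.L.IsUnimodular) (φ : polarized (latticeA 19) →ₗ[ℤ] ℤ) :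
    ∃ z, ∀ s, E.L.form z (E.emb s) = φ s := by
  obtain ⟨z, hz⟩ := hL.exists_form_eq (LinearMap.range E.emb) (fun n x hn hx =>
    mem_range_of_mem_hull ⟨n, hn, hx⟩)
    (φ ∘ₗ ((LinearEquiv.ofInjective E.emb E.injective).symm : _ →ₗ[ℤ] _))
  refine ⟨z, fun s => (hz ⟨E.emb s, s, rfl⟩).trans (congrArg φ ?_)⟩
  exact (LinearEquiv.symm_apply_eq _).2 rfl

/-- A vector dual to the first simple root. -/
theorem exists_dual_root (hL : E.L.IsUnimodular) : ∃ z : E.L,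
    (∀ i, E.L.form z (E.root i) = if i = 0 then 1 else 0) ∧ E.L.form z E.polarization = 0 := by
  obtain ⟨z, hz⟩ := exists_form_emb_eq hL ((LinearMap.proj 0 : (Fin 19 → ℤ) →ₗ[ℤ] ℤ) ∘ₗ
    LinearMap.fst ℤ (latticeA 19) latticeH)
  refine ⟨z, fun i => (hz _).trans ?_, (hz _).trans rfl⟩
  change (Pi.single i 1 : Fin 19 → ℤ) 0 = _
  rw [Pi.single_apply]
  simp [eq_comm]

/-- A vector dual to `h`. -/
theorem exists_dual_polarization (hL : E.L.IsUnimodular) : ∃ z : E.L,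
    (∀ i, E.L.form z (E.root i) = 0) ∧ E.L.form z E.polarization = 1 := by
  obtain ⟨z, hz⟩ := exists_form_emb_eq hL ((LinearMap.proj 0 : (Fin 1 → ℤ) →ₗ[ℤ] ℤ) ∘ₗ
    LinearMap.snd ℤ (latticeA 19) latticeH)
  exact ⟨z, fun i => (hz _).trans rfl, (hz _).trans rfl⟩

theorem exists_form_perp_eq (hL : E.L.IsUnimodular) (φ : E.perp →ₗ[ℤ] ℤ) :
    ∃ z, ∀ t : E.perp, E.L.form z t.1 = φ t :=
  hL.exists_form_eq (E.L.form.orthogonal E.hull) (fun _ _ hn hx =>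
    mem_orthogonal_iff_isPerp.2 ((mem_orthogonal_iff_isPerp.1 hx).of_smul hn)) φ

/-- The products with `20 ω` and `h` as a homomorphism to the discriminant group of `S`. -/
def discriminantMap (E : Extension (polarized (latticeA 19))) : E.L →ₗ[ℤ] ZMod 20 × ZMod 2 :=
  ((Int.castAddHom (ZMod 20)).toIntLinearMap ∘ₗ E.L.form.flip E.weight).prod
    ((Int.castAddHom (ZMod 2)).toIntLinearMap ∘ₗ E.L.form.flip E.polarization)

theorem discriminantMap_apply (x : E.L) : E.discriminantMap x =
    ((E.L.form x E.weight : ZMod 20), (E.L.form x E.polarization : ZMod 2)) := rfl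

/-- Vectors of L dual to the first root and to h exist by unimodularity. They map to the two
generators, since the product of ω and 20ω is -19 ≡ 1 modulo 20. -/
theorem discriminantMap_surjective (hL : E.L.IsUnimodular) :
    Function.Surjective E.discriminantMap := by
  obtain ⟨z, hz, hz'⟩ := exists_dual_root hL
  obtain ⟨w, hw, hw'⟩ := exists_dual_polarization hL
  have hzw : E.L.form z E.weight = -19 := by
    rw [form_weight_right_of_root fun i hi => by rw [hz, if_neg hi], hz, if_pos rfl, mul_one]
  have hww : E.L.form w E.weight = 0 := by
    rw [form_weight_right_of_root fun i _ => hw i, hw, mul_zero]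
  rintro ⟨a, b⟩
  obtain ⟨a, rfl⟩ := ZMod.intCast_surjective a
  obtain ⟨b, rfl⟩ := ZMod.intCast_surjective b
  refine ⟨a • z + b • w, ?_⟩
  rw [discriminantMap_apply]
  simp only [map_add, map_smul, LinearMap.add_apply, LinearMap.smul_apply, hzw, hww, hz', hw',
    smul_eq_mul, mul_zero, mul_one, add_zero, zero_add]
  refine Prod.ext ?_ rfl
  have : ((-19 : ℤ) : ZMod 20) = 1 := by decide
  rw [Int.cast_mul, this, mul_one]

/-- Modulo A₁₉, the two divisibilities say that the coefficients of ω and h/2 in the projection to S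
⊗ ℚ are multiples of 20 and 2, so that the projection lies in S. -/
theorem discriminantMap_eq_zero_iff {x : E.L} : E.discriminantMap x = 0 ↔
    ∃ s t, E.IsPerp t ∧ x = E.emb s + t := by
  rw [discriminantMap_apply, Prod.mk_eq_zero, ZMod.intCast_zmod_eq_zero_iff_dvd,
    ZMod.intCast_zmod_eq_zero_iff_dvd]
  constructor
  · rintro ⟨h1, h2⟩
    obtain ⟨a, ha⟩ := exists_sub_emb x
    obtain ⟨y, hy⟩ : ∃ y, y = x - E.emb (inclSigma _ a) := ⟨_, rfl⟩
    have hx : x = E.emb (inclSigma _ a) + y := by rw [hy]; abel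
    rw [← hy] at ha
    rw [hx, map_add, LinearMap.add_apply, form_emb_weight, form_weight_right_of_root ha] at h1
    rw [hx, map_add, LinearMap.add_apply, form_inl_polarization, zero_add] at h2
    have h3 : ∃ k, E.L.form y (E.root 0) = 20 * k := ⟨E.L.form y (E.root 0) / 20, by omega⟩
    obtain ⟨k, hk⟩ := h3
    obtain ⟨l, hl⟩ := h2
    have h4 := isPerp_twenty_smul_sub ha
    rw [hk, hl] at h4
    have h5 : (20 : ℤ) • y - ((20 * k) • E.weight + (10 * (((2 : ℕ) : ℤ) * l)) • E.polarization) =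
        (20 : ℤ) • (y - (k • E.weight + l • E.polarization)) := by
      module
    rw [h5] at h4
    refine ⟨inclSigma _ a + (k • inclSigma _ weightVec + l • vecH _), _,
      h4.of_smul (by norm_num), ?_⟩
    rw [hx, map_add, map_add, map_smul, map_smul]
    change _ = _ + (k • E.weight + l • E.polarization) + _
    abel
  · rintro ⟨s, t, ht, rfl⟩
    rw [map_add, LinearMap.add_apply, LinearMap.add_apply, form_emb_weight, form_emb_polarization,
      ht.form_weight, ht.form_polarization, add_zero, add_zero]
    exact ⟨dvd_mul_right _ _, dvd_mul_right _ _⟩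

/-- The determinant of the orthogonal complement. -/
theorem det_perp (hK : E.L.IsIsomorphic latticeK3) (b : Module.Basis (Fin 2) ℤ E.perp) :
    (E.L.form (b 0).1 (b 0).1 * E.L.form (b 1).1 (b 1).1 -
      E.L.form (b 0).1 (b 1).1 * E.L.form (b 0).1 (b 1).1).natAbs = 40 := by
  have hL : E.L.IsUnimodular := hK.elim fun f => isUnimodular_latticeK3.of_isometry f
  have hb : ∀ i, E.IsPerp (b i).1 := fun i => mem_orthogonal_iff_isPerp.1 (b i).2
  -- `P` is the restriction L → T^∨ ≅ ℤ² of functionals, onto because L is unimodular and T is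
  -- primitive. With `T` the inclusion of the complement, `G` is given by its Gram matrix.
  let P : E.L →ₗ[ℤ] (Fin 2 → ℤ) := LinearMap.pi fun i => E.L.form.flip (b i).1
  have hP : ∀ x i, P x i = E.L.form x (b i).1 := fun _ _ => rfl
  have hP_ext : ∀ x, (∀ i, E.L.form x (b i).1 = 0) → ∀ t, E.IsPerp t → E.L.form x t = 0 := by
    intro x hx t ht
    have h1 := congrArg Subtype.val (b.sum_repr ⟨t, mem_orthogonal_iff_isPerp.2 ht⟩)
    rw [Fin.sum_univ_two] at h1
    change b.repr _ 0 • (b 0).1 + b.repr _ 1 • (b 1).1 = t at h1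
    rw [← h1, map_add, map_smul, map_smul, hx, hx, smul_zero, smul_zero, add_zero]
  have hPS : Function.Surjective P := fun g => by
    obtain ⟨z, hz⟩ := exists_form_perp_eq hL (b.constr ℤ g)
    exact ⟨z, funext fun i => (hz (b i)).trans (b.constr_basis ℤ g i)⟩
  let T : (Fin 2 → ℤ) →ₗ[ℤ] E.L := Fintype.linearCombination ℤ fun i => (b i).1
  have hT : ∀ p, T p = p 0 • (b 0).1 + p 1 • (b 1).1 := fun p => by
    rw [show T p = ∑ i, p i • (b i).1 from rfl, Fin.sum_univ_two]
  have hTperp : ∀ p, E.IsPerp (T p) := fun p => by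
    rw [hT]; exact ((hb 0).smul _).add ((hb 1).smul _)
  have hTsurj : ∀ t, E.IsPerp t → ∃ p, T p = t := fun t ht => by
    have h1 := congrArg Subtype.val (b.sum_repr ⟨t, mem_orthogonal_iff_isPerp.2 ht⟩)
    rw [Fin.sum_univ_two] at h1
    exact ⟨b.repr ⟨t, mem_orthogonal_iff_isPerp.2 ht⟩, (hT _).trans h1⟩
  have hTinj : ∀ p, T p = 0 → p = 0 := fun p hp => by
    have h1 : Fintype.linearCombination ℤ b p = 0 := by
      refine Subtype.ext ((?_ : _ = T p).trans hp)
      rw [Fintype.linearCombination_apply, Fin.sum_univ_two, hT]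
      rfl
    exact funext ((Fintype.linearIndependent_iff.1 b.linearIndependent) p h1)
  let G : (Fin 2 → ℤ) →ₗ[ℤ] (Fin 2 → ℤ) := P ∘ₗ T
  have hG : Function.Injective G := (injective_iff_map_eq_zero _).2 fun p hp => by
    refine hTinj p (by_contra fun h0 => ?_)
    refine (form_self_pos_of_isPerp hK (hTperp p) h0).ne' ?_
    exact hP_ext _ (fun i => congrFun hp i) _ (hTperp p)
  have hdet : LinearMap.det G = E.L.form (b 0).1 (b 0).1 * E.L.form (b 1).1 (b 1).1 -
      E.L.form (b 0).1 (b 1).1 * E.L.form (b 0).1 (b 1).1 := by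
    rw [← LinearMap.det_toMatrix', Matrix.det_fin_two]
    have h1 : ∀ i j, LinearMap.toMatrix' G i j = E.L.form (b j).1 (b i).1 := fun i j => by
      rw [LinearMap.toMatrix'_apply]
      change E.L.form (T _) (b i).1 = _
      congr 2
      rw [hT]
      fin_cases j <;> simp
    rw [h1, h1, h1, h1, E.L.symm (b 1).1 (b 0).1]
  -- The determinant is, up to sign, the order of T^∨/T.
  let N := LinearMap.range G
  have hN := N.natAbs_det_equiv (LinearEquiv.ofInjective G hG)
  have hGN : N.subtype ∘ₗ AddMonoidHom.toIntLinearMap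
      ((LinearEquiv.ofInjective G hG : (Fin 2 → ℤ) ≃ₗ[ℤ] N) : (Fin 2 → ℤ) →+ N) = G := by
    ext; rfl
  rw [hGN, hdet] at hN
  rw [hN]
  -- The maps from L onto the discriminant groups of T and of S have the same kernel S ⊕ T, so both
  -- groups have order 40.
  have hker : LinearMap.ker (N.mkQ ∘ₗ P) = LinearMap.ker E.discriminantMap := by
    ext x
    rw [LinearMap.mem_ker, LinearMap.mem_ker, discriminantMap_eq_zero_iff, LinearMap.comp_apply,
      Submodule.mkQ_apply, Submodule.Quotient.mk_eq_zero]
    constructor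
    · rintro ⟨p, hp⟩
      obtain ⟨s, hs⟩ := mem_range_of_forall_isPerp hK (x := x - T p) (hP_ext _ fun i => by
        rw [← hP, map_sub, ← hp]
        exact sub_self (G p i))
      exact ⟨s, T p, hTperp p, by rw [hs]; abel⟩
    · rintro ⟨s, t, ht, rfl⟩
      obtain ⟨p, rfl⟩ := hTsurj t ht
      refine ⟨p, ?_⟩
      have : P (E.emb s) = 0 := funext fun i => form_emb_left_of_isPerp (hb i) s
      rw [map_add, this, zero_add]
      rfl
  have e : ((Fin 2 → ℤ) ⧸ N) ≃ₗ[ℤ] (ZMod 20 × ZMod 2) :=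
    (LinearMap.quotKerEquivOfSurjective (N.mkQ ∘ₗ P)
      (N.mkQ_surjective.comp hPS)).symm ≪≫ₗ Submodule.quotEquivOfEq _ _ hker ≪≫ₗ
      LinearMap.quotKerEquivOfSurjective _ (discriminantMap_surjective hL)
  rw [Nat.card_congr e.toEquiv]
  simp

end Extension

/-! ### Arithmetic: reduced forms of determinant 40 and residues of the glue -/

/-- From B² ≤ A² ≤ AC one gets 3A² ≤ 40, so A ≤ 3 and few cases are left. -/
theorem reduced_form_cases {A B C : ℤ} (hA : 0 < A) (hdet : 4 * A * C - B * B = 40)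
    (hB : -A ≤ B) (hB' : B ≤ A) (hAC : A ≤ C) :
    B = 0 ∧ (A = 1 ∧ C = 10 ∨ A = 2 ∧ C = 5) := by
  have h1 : B * B ≤ A * A := by nlinarith
  have h2 : A * A ≤ A * C := by nlinarith
  have h3 : A ≤ 3 := by nlinarith
  interval_cases A <;> interval_cases B <;> omega

/-- Reduction of binary quadratic forms of determinant `40`. -/
theorem exists_reduced_generators {L : EvenLattice} (n : ℕ) (t₁ t₂ : L) (A B C : ℤ)
    (h₁ : L.form t₁ t₁ = 2 * A) (h₁₂ : L.form t₁ t₂ = B) (h₂ : L.form t₂ t₂ = 2 * C)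
    (hA : 0 < A) (hn : A ≤ n) (hdet : 4 * A * C - B * B = 40) :
    ∃ u₁ u₂ : L, Submodule.span ℤ {u₁, u₂} = Submodule.span ℤ {t₁, t₂} ∧
      L.form u₁ u₂ = 0 ∧ (L.form u₁ u₁ = 2 ∧ L.form u₂ u₂ = 20 ∨
        L.form u₁ u₁ = 4 ∧ L.form u₂ u₂ = 10) := by
  induction n generalizing t₁ t₂ A B C with
  | zero => exact absurd hA (by push_cast at hn; omega)
  | succ n ih =>
    -- Gauss reduction: q is B/(2A) rounded to a nearest integer. If the new C is smaller than A,
    -- the vectors are swapped and the first norm drops, which drives the induction on the bound n.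
    obtain ⟨q, hq, hq'⟩ : ∃ q, -A ≤ B - 2 * A * q ∧ B - 2 * A * q ≤ A := by
      refine ⟨(B + A) / (2 * A), ?_, ?_⟩
      · have := Int.mul_ediv_self_le (x := B + A) (k := 2 * A) (by omega)
        linarith
      · have := Int.lt_mul_ediv_self_add (x := B + A) (k := 2 * A) (by omega)
        linarith
    have hspan : Submodule.span ℤ {t₁, t₂ - q • t₁} = Submodule.span ℤ {t₁, t₂} := by
      apply le_antisymm <;> rw [Submodule.span_le, Set.insert_subset_iff, Set.singleton_subset_iff]
      · exact ⟨Submodule.mem_span_pair.2 ⟨1, 0, by simp⟩,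
          Submodule.mem_span_pair.2 ⟨-q, 1, by module⟩⟩
      · exact ⟨Submodule.mem_span_pair.2 ⟨1, 0, by simp⟩,
          Submodule.mem_span_pair.2 ⟨q, 1, by module⟩⟩
    have h₁₂' : L.form t₁ (t₂ - q • t₁) = B - 2 * A * q := by
      rw [map_sub, map_smul, h₁, h₁₂, smul_eq_mul]; ring
    have h₂' : L.form (t₂ - q • t₁) (t₂ - q • t₁) = 2 * (C - q * B + q * q * A) := by
      simp only [map_sub, map_smul, LinearMap.sub_apply, LinearMap.smul_apply, h₁, h₂, h₁₂,
        L.symm t₂ t₁, smul_eq_mul]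
      ring
    have hdet' : 4 * A * (C - q * B + q * q * A) - (B - 2 * A * q) * (B - 2 * A * q) = 40 := by
      rw [← hdet]; ring
    obtain ⟨C', hC'⟩ : ∃ C', C' = C - q * B + q * q * A := ⟨_, rfl⟩
    obtain ⟨B', hB'⟩ : ∃ B', B' = B - 2 * A * q := ⟨_, rfl⟩
    obtain ⟨t', ht'⟩ : ∃ t', t' = t₂ - q • t₁ := ⟨_, rfl⟩
    rw [← hC', ← hB'] at hdet'
    rw [← hC', ← ht'] at h₂'
    rw [← hB', ← ht'] at h₁₂'
    rw [← hB'] at hq hq'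
    rw [← ht'] at hspan
    rcases le_or_gt A C' with hAC | hAC
    · obtain ⟨h0, h⟩ := reduced_form_cases hA hdet' hq hq' hAC
      refine ⟨t₁, t', hspan, by rw [h₁₂', h0], ?_⟩
      rcases h with ⟨rfl, hC⟩ | ⟨rfl, hC⟩
      · exact Or.inl ⟨h₁, by rw [h₂', hC]; rfl⟩
      · exact Or.inr ⟨h₁, by rw [h₂', hC]; rfl⟩
    · obtain ⟨u₁, u₂, hu, h⟩ := ih t' t₁ C' B' A h₂' (by rw [L.symm, h₁₂']) h₁
        (by nlinarith [mul_self_nonneg B']) (by push_cast at hn; omega) (by rw [← hdet']; ring)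
      exact ⟨u₁, u₂, by rw [hu, Set.pair_comm, hspan], h⟩

/-- For even i this would make j² ≡ 19 modulo 40, which is impossible; for odd i it reads j² ≡ 9
modulo 40, solved by ±3 and ±7 modulo 20. -/
theorem residues_of_glue_norm {i j r : ℤ} (h : 40 * r = -19 + 10 * (i * i) + j * j) :
    (∃ i', i = 2 * i' + 1) ∧
      ∃ n, (j = 20 * n + 3 ∨ j = 20 * n - 3) ∨ (j = 20 * n + 7 ∨ j = 20 * n - 7) := by
  obtain ⟨n, m, hj, hm, hm'⟩ : ∃ n m, j = 20 * n + m ∧ 0 ≤ m ∧ m < 20 :=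
    ⟨j / 20, j % 20, by omega, by omega, by omega⟩
  have hjj : j * j = 40 * (10 * (n * n) + n * m) + m * m := by rw [hj]; ring
  have hn1 : 20 * (n + 1) = 20 * n + 20 := by ring
  rcases Int.even_or_odd' i with ⟨i', hi | hi⟩
  · exfalso
    have hii : i * i = 4 * (i' * i') := by rw [hi]; ring
    rw [hii, hjj] at h
    interval_cases m <;> omega
  · have hii : i * i = 4 * (i' * i' + i') + 1 := by rw [hi]; ring
    rw [hii, hjj] at h
    refine ⟨⟨i', hi⟩, ?_⟩
    interval_cases m
    all_goals first
      | (exfalso; omega)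
      | exact ⟨n, by omega⟩
      | exact ⟨n + 1, by omega⟩

/-- Modulo 4, the other parities of i and q leave a nonzero right hand side. -/
theorem odd_of_polarization_norm {i q r : ℤ} (h : 4 * r = 1 + i * i + 10 * (q * q)) :
    (∃ i', i = 2 * i' + 1) ∧ ∃ q', q = 2 * q' + 1 := by
  rcases Int.even_or_odd' i with ⟨i', hi | hi⟩ <;> rcases Int.even_or_odd' q with ⟨q', hq | hq⟩
  · have h1 : i * i = 4 * (i' * i') := by rw [hi]; ring
    have h2 : q * q = 4 * (q' * q') := by rw [hq]; ring
    omega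
  · have h1 : i * i = 4 * (i' * i') := by rw [hi]; ring
    have h2 : q * q = 4 * (q' * q' + q') + 1 := by rw [hq]; ring
    omega
  · have h1 : i * i = 4 * (i' * i' + i') + 1 := by rw [hi]; ring
    have h2 : q * q = 4 * (q' * q') := by rw [hq]; ring
    omega
  · exact ⟨⟨i', hi⟩, ⟨q', hq⟩⟩

/-- Modulo 5 the equation reads 2j² ≡ 4, and 2 is not a square modulo 5. This excludes the form [4,
10]. -/
theorem glue_norm_ne {i j r : ℤ} (h : 40 * r = -19 + 5 * (i * i) + 2 * (j * j)) : False := by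
  obtain ⟨n, m, hj, hm, hm'⟩ : ∃ n m, j = 5 * n + m ∧ 0 ≤ m ∧ m < 5 :=
    ⟨j / 5, j % 5, by omega, by omega, by omega⟩
  have hjj : j * j = 5 * (5 * (n * n) + 2 * (n * m)) + m * m := by rw [hj]; ring
  rw [hjj] at h
  interval_cases m <;> omega

/-! ### Frames: normal form of the glue -/

namespace Extension

variable {E : Extension (polarized (latticeA 19))}

/-- Orthogonal vectors of square `2` and `20` in the orthogonal complement of `S`, and a vector of
`E.L` that glues the discriminant of `A₁₉` to that of the complement. -/
structure GlueFrame (E : Extension (polarized (latticeA 19))) (k : ℤ) (t₁ t₂ x : E.L) : Prop where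
  perp₁ : E.IsPerp t₁
  perp₂ : E.IsPerp t₂
  form₁ : E.L.form t₁ t₁ = 2
  form₁₂ : E.L.form t₁ t₂ = 0
  form₂ : E.L.form t₂ t₂ = 20
  glue : (20 : ℤ) • x = E.weight + (10 : ℤ) • t₁ + k • t₂

/-- A glue frame that, with a second glue vector, generates the whole lattice. -/
structure FullFrame (E : Extension (polarized (latticeA 19))) (k : ℤ) (t₁ t₂ x y : E.L) : Prop
    extends GlueFrame E k t₁ t₂ x where
  glue' : (2 : ℤ) • y = E.polarization + t₁ + t₂
  span : ∀ t, E.IsPerp t → ∃ p q : ℤ, t = p • t₁ + q • t₂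

/-- Glue vectors matter only modulo T, so their coefficients can be brought to the standard
residues. -/
theorem fullFrame_of_dual {u₁ u₂ z w : E.L} {i n a b k : ℤ} (perp₁ : E.IsPerp u₁)
    (perp₂ : E.IsPerp u₂) (form₁ : E.L.form u₁ u₁ = 2) (form₁₂ : E.L.form u₁ u₂ = 0)
    (form₂ : E.L.form u₂ u₂ = 20) (span : ∀ t, E.IsPerp t → ∃ p q : ℤ, t = p • u₁ + q • u₂)
    (hz : (20 : ℤ) • z = E.weight + (10 * (2 * i + 1)) • u₁ + (20 * n + k) • u₂)
    (hw : (2 : ℤ) • w = E.polarization + (2 * a + 1) • u₁ + (2 * b + 1) • u₂) :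
    FullFrame E k u₁ u₂ (z - i • u₁ - n • u₂) (w - a • u₁ - b • u₂) where
  perp₁ := perp₁
  perp₂ := perp₂
  form₁ := form₁
  form₁₂ := form₁₂
  form₂ := form₂
  glue := by rw [smul_sub, smul_sub, hz]; module
  glue' := by rw [smul_sub, smul_sub, hw]; module
  span := span

/-- Passing from u₂ to -u₂ turns the residue -k into k; the odd coefficient 2b + 1 becomes 2(-b - 1)
+ 1. -/
theorem fullFrame_of_dual_neg {u₁ u₂ z w : E.L} {i n a b k : ℤ} (perp₁ : E.IsPerp u₁)
    (perp₂ : E.IsPerp u₂) (form₁ : E.L.form u₁ u₁ = 2) (form₁₂ : E.L.form u₁ u₂ = 0)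
    (form₂ : E.L.form u₂ u₂ = 20) (span : ∀ t, E.IsPerp t → ∃ p q : ℤ, t = p • u₁ + q • u₂)
    (hz : (20 : ℤ) • z = E.weight + (10 * (2 * i + 1)) • u₁ + (20 * n - k) • u₂)
    (hw : (2 : ℤ) • w = E.polarization + (2 * a + 1) • u₁ + (2 * b + 1) • u₂) :
    ∃ t₁ t₂ x y, FullFrame E k t₁ t₂ x y :=
  ⟨_, _, _, _, fullFrame_of_dual (u₁ := u₁) (u₂ := (-1 : ℤ) • u₂) (z := z) (w := w) (i := i)
    (n := -n) (a := a) (b := -b - 1) (k := k) perp₁ (perp₂.smul _) form₁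
    (by rw [map_smul, form₁₂, smul_zero])
    (by rw [map_smul, map_smul, LinearMap.smul_apply, form₂]; rfl)
    (fun t ht => by
      obtain ⟨p, q, rfl⟩ := span t ht
      exact ⟨p, -q, by module⟩)
    (by rw [hz]; module) (by rw [hw]; module)⟩

theorem exists_orthogonal_generators (hK : E.L.IsIsomorphic latticeK3) :
    ∃ u₁ u₂ : E.L, E.IsPerp u₁ ∧ E.IsPerp u₂ ∧
      (∀ t, E.IsPerp t → ∃ p q : ℤ, t = p • u₁ + q • u₂) ∧ E.L.form u₁ u₂ = 0 ∧
      (E.L.form u₁ u₁ = 2 ∧ E.L.form u₂ u₂ = 20 ∨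
        E.L.form u₁ u₁ = 4 ∧ E.L.form u₂ u₂ = 10) := by
  have hrank : Module.finrank ℤ E.perp = 2 := by
    have h1 := finrank_perp_add (E := E)
    have h2 : Module.finrank ℤ E.L = 22 :=
      hK.elim fun f => f.toEquiv.finrank_eq.trans finrank_latticeK3
    omega
  let b : Module.Basis (Fin 2) ℤ E.perp := Module.finBasisOfFinrankEq ℤ E.perp hrank
  have hdet := det_perp hK b
  have hb : ∀ i, E.IsPerp (b i).1 := fun i => mem_orthogonal_iff_isPerp.1 (b i).2
  have hspan : ∀ t, E.IsPerp t ↔ t ∈ Submodule.span ℤ {(b 0).1, (b 1).1} := fun t => by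
    rw [Submodule.mem_span_pair]
    constructor
    · intro ht
      have h1 := congrArg Subtype.val (b.sum_repr ⟨t, mem_orthogonal_iff_isPerp.2 ht⟩)
      rw [Fin.sum_univ_two] at h1
      exact ⟨_, _, h1⟩
    · rintro ⟨p, q, rfl⟩
      exact ((hb 0).smul _).add ((hb 1).smul _)
  obtain ⟨A, hA⟩ := E.L.even (b 0).1
  obtain ⟨C, hC⟩ := E.L.even (b 1).1
  obtain ⟨B, hB⟩ : ∃ B, E.L.form (b 0).1 (b 1).1 = B := ⟨_, rfl⟩
  have hb0 : (b 0).1 ≠ 0 := fun h => b.ne_zero 0 (Subtype.ext h)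
  have hA0 : 0 < A := by
    have := form_self_pos_of_isPerp hK (hb 0) hb0
    omega
  rw [hA, hB, hC] at hdet
  have hdet' : 4 * A * C - B * B = 40 := by
    have h1 : (A + A) * (C + C) - B * B = 4 * A * C - B * B := by ring
    rw [h1] at hdet
    rcases Int.natAbs_eq (4 * A * C - B * B) with h | h
    · rw [h, hdet]; rfl
    · exfalso
      rw [hdet] at h
      -- This vector is orthogonal to the first basis vector and has square 2A times the
      -- determinant, so determinant -40 contradicts definiteness.
      have h2 : E.L.form (B • (b 0).1 - (2 * A) • (b 1).1) (B • (b 0).1 - (2 * A) • (b 1).1) =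
          2 * A * (4 * A * C - B * B) := by
        simp only [map_sub, map_smul, LinearMap.sub_apply, LinearMap.smul_apply, hA, hB, hC,
          E.L.symm (b 1).1 (b 0).1, smul_eq_mul]
        ring
      have h3 := form_self_pos_of_isPerp hK
        (((hb 0).smul B).sub ((hb 1).smul (2 * A))) (fun h0 => by
          rw [h0, map_zero, h] at h2
          push_cast at h2
          omega)
      rw [h2, h] at h3
      push_cast at h3
      omega
  obtain ⟨u₁, u₂, hu, h₁₂, h⟩ := exists_reduced_generators A.toNat (b 0).1 (b 1).1 A B C
    (by rw [hA]; ring) hB (by rw [hC]; ring) hA0 (by omega) hdet'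
  refine ⟨u₁, u₂, (hspan _).2 ?_, (hspan _).2 ?_, fun t ht => ?_, h₁₂, h⟩
  · rw [← hu]; exact Submodule.subset_span (by simp)
  · rw [← hu]; exact Submodule.subset_span (by simp)
  · rw [hspan, ← hu, Submodule.mem_span_pair] at ht
    obtain ⟨p, q, hpq⟩ := ht
    exact ⟨p, q, hpq.symm⟩

/-- Every abstract homological type has a full frame, of one of the two kinds. -/
theorem exists_fullFrame (hK : E.L.IsIsomorphic latticeK3) :
    (∃ t₁ t₂ x y, FullFrame E 3 t₁ t₂ x y) ∨ ∃ t₁ t₂ x y, FullFrame E 7 t₁ t₂ x y := by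
  have hL : E.L.IsUnimodular := hK.elim fun f => isUnimodular_latticeK3.of_isometry f
  obtain ⟨u₁, u₂, p₁, p₂, span, h₁₂, h⟩ := exists_orthogonal_generators hK
  obtain ⟨z, hz, hz'⟩ := exists_dual_root hL
  obtain ⟨w, hw, hw'⟩ := exists_dual_polarization hL
  have hzp : E.IsPerp ((20 : ℤ) • z - E.weight) := by
    have := isPerp_twenty_smul_sub (y := z) fun i hi => by rw [hz, if_neg hi]
    rw [hz, if_pos rfl, hz', mul_zero, zero_smul, add_zero, one_smul] at this
    exact this
  have hwp : E.IsPerp ((2 : ℤ) • w - E.polarization) := by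
    refine isPerp_of_root (fun i => ?_) ?_
    · rw [map_sub, LinearMap.sub_apply, map_smul, LinearMap.smul_apply, hw,
        form_polarization_root]
      rfl
    · rw [map_sub, LinearMap.sub_apply, map_smul, LinearMap.smul_apply, hw',
        form_polarization_self]
      rfl
  obtain ⟨p, q, hpq⟩ := span _ hzp
  obtain ⟨p', q', hpq'⟩ := span _ hwp
  rw [sub_eq_iff_eq_add] at hpq hpq'
  have h₂₁ : E.L.form u₂ u₁ = 0 := by rw [E.L.symm, h₁₂]
  have hW₁ : E.L.form E.weight u₁ = 0 := form_emb_left_of_isPerp p₁ _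
  have hW₂ : E.L.form E.weight u₂ = 0 := form_emb_left_of_isPerp p₂ _
  have hH₁ : E.L.form E.polarization u₁ = 0 := form_emb_left_of_isPerp p₁ _
  have hH₂ : E.L.form E.polarization u₂ = 0 := form_emb_left_of_isPerp p₂ _
  -- Integrality of the products with u₁, u₂ and evenness of z², w² are the only constraints used on
  -- the coefficients p, q, p', q'.
  have e₁ : 20 * E.L.form z u₁ = p * E.L.form u₁ u₁ := by
    have := congrArg (fun v => E.L.form v u₁) hpq
    simpa [hW₁, h₂₁] using this
  have e₂ : 20 * E.L.form z u₂ = q * E.L.form u₂ u₂ := by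
    have := congrArg (fun v => E.L.form v u₂) hpq
    simpa [hW₂, h₁₂] using this
  have e₃ : 20 * (20 * E.L.form z z) =
      -380 + p * p * E.L.form u₁ u₁ + q * q * E.L.form u₂ u₂ := by
    have h1 : E.L.form ((20 : ℤ) • z) ((20 : ℤ) • z) = 20 * (20 * E.L.form z z) := by simp
    rw [← h1, hpq]
    simp only [map_add, map_smul, LinearMap.add_apply, LinearMap.smul_apply, hW₁, hW₂,
      form_weight_weight, p₁.form_weight, p₂.form_weight, h₁₂, h₂₁, smul_eq_mul]
    ring
  have e₄ : 2 * E.L.form w u₁ = p' * E.L.form u₁ u₁ := by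
    have := congrArg (fun v => E.L.form v u₁) hpq'
    simpa [hH₁, h₂₁] using this
  have e₆ : 2 * (2 * E.L.form w w) =
      2 + p' * p' * E.L.form u₁ u₁ + q' * q' * E.L.form u₂ u₂ := by
    have h1 : E.L.form ((2 : ℤ) • w) ((2 : ℤ) • w) = 2 * (2 * E.L.form w w) := by simp
    rw [← h1, hpq']
    simp only [map_add, map_smul, LinearMap.add_apply, LinearMap.smul_apply, hH₁, hH₂,
      form_polarization_self, p₁.form_polarization, p₂.form_polarization, h₁₂, h₂₁, smul_eq_mul]
    ring
  obtain ⟨r, hr⟩ := E.L.even z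
  obtain ⟨r', hr'⟩ := E.L.even w
  rw [hr] at e₃
  rw [hr'] at e₆
  rcases h with ⟨h₁, h₂⟩ | ⟨h₁, h₂⟩
  · rw [h₁] at e₁ e₃ e₆
    rw [h₂] at e₂ e₃ e₆
    obtain ⟨i, rfl⟩ : ∃ i, p = 10 * i := ⟨E.L.form z u₁, by omega⟩
    obtain ⟨⟨i, rfl⟩, n, hn⟩ := residues_of_glue_norm (i := i) (j := q) (r := r) (by linarith)
    obtain ⟨⟨a, rfl⟩, b, rfl⟩ := odd_of_polarization_norm (i := p') (q := q') (r := r')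
      (by linarith)
    have hpq'' : (2 : ℤ) • w = E.polarization + (2 * a + 1) • u₁ + (2 * b + 1) • u₂ := by
      rw [hpq']; abel
    have hpq₂ : (20 : ℤ) • z = E.weight + (10 * (2 * i + 1)) • u₁ + q • u₂ := by
      rw [hpq]; abel
    rcases hn with (rfl | rfl) | (rfl | rfl)
    · exact Or.inl ⟨_, _, _, _, fullFrame_of_dual p₁ p₂ h₁ h₁₂ h₂ span hpq₂ hpq''⟩
    · exact Or.inl (fullFrame_of_dual_neg p₁ p₂ h₁ h₁₂ h₂ span hpq₂ hpq'')
    · exact Or.inr ⟨_, _, _, _, fullFrame_of_dual p₁ p₂ h₁ h₁₂ h₂ span hpq₂ hpq''⟩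
    · exact Or.inr (fullFrame_of_dual_neg p₁ p₂ h₁ h₁₂ h₂ span hpq₂ hpq'')
  · exfalso
    rw [h₁] at e₁ e₃
    rw [h₂] at e₂ e₃
    obtain ⟨i, rfl⟩ : ∃ i, p = 5 * i := ⟨E.L.form z u₁, by omega⟩
    obtain ⟨j, rfl⟩ : ∃ j, q = 2 * j := ⟨E.L.form z u₂, by omega⟩
    exact glue_norm_ne (i := i) (j := j) (r := r) (by linarith)

end Extension

/-! ### The invariant ±k modulo 20 -/

/-- The symmetries of the Dynkin graph `A₁₉`. -/
theorem eq_id_or_eq_rev_of_cartanMatrix {π : Fin 19 → Fin 19}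
    (h : ∀ i j, CartanMatrix.A 19 (π i) (π j) = CartanMatrix.A 19 i j) :
    (∀ i, π i = i) ∨ ∀ i, π i = i.rev := by
  have hinj : ∀ i j, π i = π j → i = j := fun i j hij => by
    have h1 := h i j
    rw [hij] at h1
    simp only [CartanMatrix.A, Matrix.of_apply, if_true] at h1
    by_contra hne
    rw [if_neg hne] at h1
    split_ifs at h1
    omega
  have hadj : ∀ i j : Fin 19, (i : ℕ) + 1 = j →
      (π i : ℕ) + 1 = π j ∨ (π j : ℕ) + 1 = π i := fun i j hij => by
    have h1 := h i j
    have hne : i ≠ j := by rintro rfl; omega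
    simp only [CartanMatrix.A, Matrix.of_apply, if_neg hne, hij, true_or, if_true] at h1
    split_ifs at h1 with h2 h3
    exact h3
  -- Extended to ℕ with integer values, π moves by ±1 at each step and never turns back, by
  -- injectivity; so it is linear on 0, …, 18, and the range 0, …, 18 of its values fixes the
  -- starting point.
  obtain ⟨g, hg⟩ : ∃ g : ℕ → ℤ, ∀ i : Fin 19, g i = (π i : ℕ) :=
    ⟨fun i => if hi : i < 19 then ((π ⟨i, hi⟩ : ℕ) : ℤ) else 0, fun i => by simp⟩
  have hstep : ∀ i, i + 1 < 19 → g (i + 1) = g i + 1 ∨ g (i + 1) = g i - 1 := fun i hi => by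
    have h1 := hadj ⟨i, by omega⟩ ⟨i + 1, hi⟩ rfl
    have h2 := hg ⟨i, by omega⟩
    have h3 := hg ⟨i + 1, hi⟩
    simp only at h2 h3
    omega
  have hne : ∀ i, i + 2 < 19 → g (i + 2) ≠ g i := fun i hi hgi => by
    have h2 := hg ⟨i, by omega⟩
    have h3 := hg ⟨i + 2, hi⟩
    simp only at h2 h3
    have h4 := hinj ⟨i, by omega⟩ ⟨i + 2, hi⟩ (Fin.ext (by omega))
    simp at h4
  have hlin : ∀ i, i + 1 < 19 → g (i + 1) - g i = g 1 - g 0 := fun i => by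
    induction i with
    | zero => intro _; rfl
    | succ i ih =>
      intro hi
      have h1 := ih (by omega)
      have h2 := hstep i (by omega)
      have h3 := hstep (i + 1) hi
      have h4 : g (i + 1 + 1) ≠ g i := hne i hi
      omega
  have hlin' : ∀ i : ℕ, i < 19 → g i = g 0 + i * (g 1 - g 0) := fun i => by
    induction i with
    | zero => intro _; simp
    | succ i ih =>
      intro hi
      have h1 := ih (by omega)
      have h2 := hlin i hi
      push_cast
      linarith
  have h18 := hlin' 18 (by omega)
  have b0 := hg 0
  have b18 := hg 18
  have c0 := (π 0).isLt
  have c18 := (π 18).isLt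
  have hs := hstep 0 (by omega)
  simp only [Fin.val_zero, zero_add] at b0 hs
  have b18' : g 18 = (π 18 : ℕ) := b18
  push_cast at h18
  rcases hs with hs | hs
  · left
    intro i
    have h1 := hlin' i i.isLt
    have h2 := hg i
    have h3 : g 1 - g 0 = 1 := by omega
    rw [h3] at h1 h18
    exact Fin.ext (by omega)
  · right
    intro i
    have h1 := hlin' i i.isLt
    have h2 := hg i
    have h3 : g 1 - g 0 = -1 := by omega
    rw [h3] at h1 h18
    refine Fin.ext ?_
    rw [Fin.val_rev]
    omega

theorem weightVec_eq_sum : weightVec = ∑ i : Fin 19, ((i : ℤ) - 19) • simpleRoot i :=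
  sum_smul_simpleRoot weightVec

/-- Admissible isometries act on the discriminant group of `A₁₉` by `±1`. -/
theorem exists_sign_of_mem_admissible {s : Isometry (polarized (latticeA 19)) (polarized _)}
    (hs : s ∈ admissible (latticeA 19) (basisA 19)) :
    ∃ (ε : ℤ) (a : latticeA 19), ε * ε = 1 ∧
      s (inclSigma _ weightVec) = ε • inclSigma _ weightVec + (20 : ℤ) • inclSigma _ a := by
  have h1 : ∀ i : Fin 19, ∃ j : Fin 19,
      s (inclSigma _ (simpleRoot i)) = inclSigma _ (simpleRoot j) := fun i => by
    have h2 : s (inclSigma _ (simpleRoot i)) ∈ s '' (inclSigma _ '' basisA 19) :=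
      ⟨_, ⟨_, ⟨i, rfl⟩, rfl⟩, rfl⟩
    rw [hs.2] at h2
    obtain ⟨_, ⟨j, rfl⟩, hj⟩ := h2
    exact ⟨j, hj.symm⟩
  choose π hπ using h1
  have hW : s (inclSigma _ weightVec) =
      ∑ i : Fin 19, ((i : ℤ) - 19) • inclSigma _ (simpleRoot (π i)) := by
    rw [weightVec_eq_sum, map_sum, map_sum]
    refine Finset.sum_congr rfl fun i _ => ?_
    rw [map_smul, map_smul, hπ]
  have hA : ∀ i j, CartanMatrix.A 19 (π i) (π j) = CartanMatrix.A 19 i j := fun i j => by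
    have h2 := s.form_map (inclSigma _ (simpleRoot i)) (inclSigma _ (simpleRoot j))
    rw [hπ, hπ, polarized_form_inl, polarized_form_inl] at h2
    have h3 : -CartanMatrix.A 19 (π i) (π j) = -CartanMatrix.A 19 i j :=
      (latticeA_form_simpleRoot _ _ _).symm.trans (h2.trans (latticeA_form_simpleRoot _ _ _))
    exact neg_injective h3
  rcases eq_id_or_eq_rev_of_cartanMatrix hA with h | h
  · refine ⟨1, 0, rfl, ?_⟩
    rw [hW, map_zero, smul_zero, add_zero, one_smul, weightVec_eq_sum, map_sum]
    refine Finset.sum_congr rfl fun i _ => ?_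
    rw [h, map_smul]
  -- The reversal maps 20ω to the sum of (-1 - j) e_j, which is -20ω minus 20 times the sum of the
  -- simple roots.
  · refine ⟨-1, -∑ i, simpleRoot i, rfl, ?_⟩
    rw [hW, weightVec_eq_sum, map_neg, map_sum, map_sum, smul_neg, Finset.smul_sum,
      Finset.smul_sum, ← sub_eq_add_neg, ← Finset.sum_sub_distrib]
    refine Finset.sum_nbij' Fin.rev Fin.rev (by simp) (by simp) (by simp) (by simp) fun i _ => ?_
    rw [h, map_smul, smul_smul, ← sub_smul]
    congr 1
    rw [Fin.val_rev]
    have := i.isLt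
    omega

namespace Extension

variable {E F : Extension (polarized (latticeA 19))}

/-- The sign ε by which the isomorphism acts on ω is absorbed into the images of t₁, t₂ and x, so k
itself is unchanged. -/
theorem GlueFrame.exists_of_areIsomorphic {k : ℤ} {t₁ t₂ x : E.L} (h : GlueFrame E k t₁ t₂ x)
    (hEF : AreIsomorphic (basisA 19) E F) : ∃ t₁' t₂' x', GlueFrame F k t₁' t₂' x' := by
  obtain ⟨f, s, hs, hf⟩ := hEF
  obtain ⟨ε, a, hε, hW⟩ := exists_sign_of_mem_admissible hs
  have hperp : ∀ t, E.IsPerp t → F.IsPerp (ε • f t) := fun t ht => IsPerp.smul _ fun s' => by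
    obtain ⟨s₀, rfl⟩ := s.toEquiv.surjective s'
    rw [← hf, f.form_map]
    exact ht _
  have hform : ∀ u v, F.L.form (ε • f u) (ε • f v) = E.L.form u v := fun u v => by
    rw [map_smul, map_smul, LinearMap.smul_apply, f.form_map, smul_smul, hε, one_smul]
  refine ⟨ε • f t₁, ε • f t₂, ε • (f x - F.emb (inclSigma _ a)), hperp _ h.perp₁, hperp _ h.perp₂,
    by rw [hform, h.form₁], by rw [hform, h.form₁₂], by rw [hform, h.form₂], ?_⟩
  have h1 : (20 : ℤ) • f x = ε • F.weight + (20 : ℤ) • F.emb (inclSigma _ a) +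
      (10 : ℤ) • f t₁ + k • f t₂ := by
    rw [← map_smul, h.glue, map_add, map_add, map_smul, map_smul, weight, hf, hW, map_add,
      map_smul, map_smul]
    rfl
  rw [smul_comm, smul_sub, h1]
  have h2 : ε • ε • F.weight = F.weight := by rw [smul_smul, hε, one_smul]
  calc _ = ε • ε • F.weight + (10 : ℤ) • ε • f t₁ + k • ε • f t₂ := by module
    _ = _ := by rw [h2]

/-- The only vectors of square 2 in T are ±t₁, so u₁ = ±t₁ and, by orthogonality, u₂ = ±t₂. The glue
vectors then differ by an element of T, and the coefficients at t₂ are compared. -/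
theorem FullFrame.congr_of_glueFrame {k l : ℤ} {t₁ t₂ x y u₁ u₂ x' : E.L}
    (h : FullFrame E k t₁ t₂ x y) (h' : GlueFrame E l u₁ u₂ x') :
    ∃ n, k - l = 20 * n ∨ k + l = 20 * n := by
  have h₂₁ : E.L.form t₂ t₁ = 0 := by rw [E.L.symm, h.form₁₂]
  have hform : ∀ p q p' q' : ℤ, E.L.form (p • t₁ + q • t₂) (p' • t₁ + q' • t₂) =
      2 * (p * p') + 20 * (q * q') := fun p q p' q' => by
    simp only [map_add, map_smul, LinearMap.add_apply, LinearMap.smul_apply, h.form₁, h.form₂,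
      h.form₁₂, h₂₁, smul_eq_mul]
    ring
  obtain ⟨p, q, hu₁⟩ := h.span _ h'.perp₁
  obtain ⟨p', q', hu₂⟩ := h.span _ h'.perp₂
  have e₁ := h'.form₁
  have e₁₂ := h'.form₁₂
  have e₂ := h'.form₂
  rw [hu₁, hform] at e₁
  rw [hu₁, hu₂, hform] at e₁₂
  rw [hu₂, hform] at e₂
  have hq : q = 0 := by nlinarith [mul_self_nonneg p, mul_self_nonneg q]
  rw [hq] at e₁ e₁₂
  have hp0 : p ≠ 0 := by rintro rfl; omega
  have hp' : p' = 0 := by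
    have : p * p' = 0 := by linarith
    exact (mul_eq_zero.1 this).resolve_left hp0
  rw [hp'] at e₂
  have hq' : q' = 1 ∨ q' = -1 := mul_self_eq_one_iff.1 (by linarith)
  have hd : (20 : ℤ) • (x - x') = (10 - 10 * p) • t₁ + (k - l * q') • t₂ := by
    rw [smul_sub, h.glue, h'.glue, hu₁, hu₂, hq, hp']
    module
  have hperp : E.IsPerp (x - x') := IsPerp.of_smul (n := 20) (by norm_num) (by
    rw [hd]; exact (h.perp₁.smul _).add (h.perp₂.smul _))
  obtain ⟨a, b, hab⟩ := h.span _ hperp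
  have h3 := congrArg (fun v => E.L.form v ((0 : ℤ) • t₁ + (1 : ℤ) • t₂)) hd
  rw [hab, smul_add, smul_smul, smul_smul, hform, hform] at h3
  rcases hq' with rfl | rfl
  · exact ⟨b, Or.inl (by linarith)⟩
  · exact ⟨b, Or.inr (by linarith)⟩

/-! ### A full frame determines the extension -/

/-- The homomorphism from `S ⊕ ℤ⁴` defined by a frame. -/
def frameMap (E : Extension (polarized (latticeA 19))) (t₁ t₂ x y : E.L) :
    (polarized (latticeA 19) × ℤ × ℤ × ℤ × ℤ) →ₗ[ℤ] E.L :=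
  E.emb.coprod ((LinearMap.toSpanSingleton ℤ E.L t₁).coprod
    ((LinearMap.toSpanSingleton ℤ E.L t₂).coprod
      ((LinearMap.toSpanSingleton ℤ E.L x).coprod (LinearMap.toSpanSingleton ℤ E.L y))))

theorem frameMap_apply (t₁ t₂ x y : E.L) (s p q m n) :
    frameMap E t₁ t₂ x y (s, p, q, m, n) =
      E.emb s + (p • t₁ + (q • t₂ + (m • x + n • y))) := rfl

/-- The vectors x and y have the same products with S as ω and h/2, so modulo A₁₉ every vector
becomes orthogonal to S after subtracting multiples of x and y. -/
theorem FullFrame.frameMap_surjective {k : ℤ} {t₁ t₂ x y : E.L} (h : FullFrame E k t₁ t₂ x y) :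
    Function.Surjective (frameMap E t₁ t₂ x y) := fun z => by
  obtain ⟨a, ha⟩ := exists_sub_emb z
  obtain ⟨z', hz'⟩ : ∃ z', z' = z - E.emb (inclSigma _ a) := ⟨_, rfl⟩
  rw [← hz'] at ha
  have hx : ∀ i, E.L.form x (E.root i) = if i = 0 then 1 else 0 := fun i => by
    have h1 := congrArg (fun v => E.L.form v (E.root i)) h.glue
    simp only [map_add, map_smul, LinearMap.add_apply, LinearMap.smul_apply, form_weight_root,
      smul_eq_mul] at h1
    rw [root, h.perp₁, h.perp₂] at h1
    rw [root]
    split_ifs at h1 ⊢ <;> omega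
  have hx' : E.L.form x E.polarization = 0 := by
    have h1 := congrArg (fun v => E.L.form v E.polarization) h.glue
    simp only [map_add, map_smul, LinearMap.add_apply, LinearMap.smul_apply,
      form_weight_polarization, h.perp₁.form_polarization, h.perp₂.form_polarization,
      smul_eq_mul] at h1
    omega
  have hy : ∀ i, E.L.form y (E.root i) = 0 := fun i => by
    have h1 := congrArg (fun v => E.L.form v (E.root i)) h.glue'
    simp only [map_add, map_smul, LinearMap.add_apply, LinearMap.smul_apply,
      form_polarization_root, smul_eq_mul] at h1
    rw [root, h.perp₁, h.perp₂] at h1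
    rw [root]
    omega
  have hy' : E.L.form y E.polarization = 1 := by
    have h1 := congrArg (fun v => E.L.form v E.polarization) h.glue'
    simp only [map_add, map_smul, LinearMap.add_apply, LinearMap.smul_apply,
      form_polarization_self, h.perp₁.form_polarization, h.perp₂.form_polarization,
      smul_eq_mul] at h1
    omega
  have hperp : E.IsPerp (z' - E.L.form z' (E.root 0) • x - E.L.form z' E.polarization • y) := by
    refine isPerp_of_root (fun i => ?_) ?_
    · simp only [map_sub, map_smul, LinearMap.sub_apply, LinearMap.smul_apply, hx, hy, smul_eq_mul]
      by_cases hi : i = 0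
      · subst hi; rw [if_pos rfl]; ring
      · rw [if_neg hi, ha i hi]; ring
    · simp only [map_sub, map_smul, LinearMap.sub_apply, LinearMap.smul_apply, hx', hy',
        smul_eq_mul]
      ring
  obtain ⟨p, q, hpq⟩ := h.span _ hperp
  refine ⟨(inclSigma _ a, p, q, E.L.form z' (E.root 0), E.L.form z' E.polarization), ?_⟩
  rw [frameMap_apply, ← add_assoc (p • t₁), ← hpq, hz']
  abel

/-- Multiplication by 20 carries everything into S ⊕ T, whose form is known; hence 400 = 20². The
point is that the right hand side depends on the frame only through k. -/
theorem FullFrame.form_frameMap {k : ℤ} {t₁ t₂ x y : E.L} (h : FullFrame E k t₁ t₂ x y)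
    (s p q m n s' p' q' m' n') :
    400 * E.L.form (frameMap E t₁ t₂ x y (s, p, q, m, n))
      (frameMap E t₁ t₂ x y (s', p', q', m', n')) =
    (polarized (latticeA 19)).form
        ((20 : ℤ) • s + m • inclSigma _ weightVec + (10 * n) • vecH _)
        ((20 : ℤ) • s' + m' • inclSigma _ weightVec + (10 * n') • vecH _) +
      2 * ((20 * p + 10 * m + 10 * n) * (20 * p' + 10 * m' + 10 * n')) +
      20 * ((20 * q + k * m + 10 * n) * (20 * q' + k * m' + 10 * n')) := by
  have key : ∀ s p q m n, (20 : ℤ) • frameMap E t₁ t₂ x y (s, p, q, m, n) =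
      E.emb ((20 : ℤ) • s + m • inclSigma _ weightVec + (10 * n) • vecH _) +
        (20 * p + 10 * m + 10 * n) • t₁ + (20 * q + k * m + 10 * n) • t₂ := fun s p q m n => by
    have h1 : (20 : ℤ) • (m • x) = m • (E.weight + (10 : ℤ) • t₁ + k • t₂) := by
      rw [smul_comm, h.glue]
    have h2 : (20 : ℤ) • (n • y) = (10 * n) • (E.polarization + t₁ + t₂) := by
      rw [← h.glue', smul_smul, smul_smul]; congr 1; ring
    rw [frameMap_apply, smul_add, smul_add, smul_add, smul_add, h1, h2, map_add, map_add,
      map_smul, map_smul, map_smul]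
    change _ = _ + m • E.weight + (10 * n) • E.polarization + _ + _
    module
  have h20 : ∀ u v : E.L, E.L.form ((20 : ℤ) • u) ((20 : ℤ) • v) = 400 * E.L.form u v :=
    fun u v => by
      rw [map_smul, map_smul, LinearMap.smul_apply, smul_smul]; rfl
  rw [← h20, key, key]
  have h₂₁ : E.L.form t₂ t₁ = 0 := by rw [E.L.symm, h.form₁₂]
  simp only [map_add E.L.form, map_add (E.L.form _), map_smul E.L.form, map_smul (E.L.form _),
    LinearMap.add_apply, LinearMap.smul_apply, h.perp₁ _, h.perp₂ _,
    form_emb_left_of_isPerp h.perp₁, form_emb_left_of_isPerp h.perp₂, h.form₁, h.form₂, h.form₁₂,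
    h₂₁, E.form_emb, smul_eq_mul]
  ring

/-- Extensions with frames of the same kind are isomorphic. -/
theorem FullFrame.exists_isometry {k : ℤ} {t₁ t₂ x y : E.L} {u₁ u₂ x' y' : F.L}
    (h : FullFrame E k t₁ t₂ x y) (h' : FullFrame F k u₁ u₂ x' y') (hE : E.L.IsNondegenerate)
    (hF : F.L.IsNondegenerate) :
    ∃ f : Isometry E.L F.L, (∀ s, f (E.emb s) = F.emb s) ∧ f t₁ = u₁ ∧ f t₂ = u₂ := by
  obtain ⟨f, hf⟩ := exists_isometry_of_surjective hE hF (frameMap E t₁ t₂ x y)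
    (frameMap F u₁ u₂ x' y') h.frameMap_surjective h'.frameMap_surjective
    fun ⟨s, p, q, m, n⟩ ⟨s', p', q', m', n'⟩ => by
      have h1 := (h.form_frameMap s p q m n s' p' q' m' n').trans
        (h'.form_frameMap s p q m n s' p' q' m' n').symm
      linarith
  refine ⟨f, fun s => ?_, ?_, ?_⟩
  · have := hf (s, 0, 0, 0, 0)
    rw [frameMap_apply, frameMap_apply] at this
    simpa using this
  · have := hf (0, 1, 0, 0, 0)
    rw [frameMap_apply, frameMap_apply] at this
    simpa using this
  · have := hf (0, 0, 1, 0, 0)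
    rw [frameMap_apply, frameMap_apply] at this
    simpa using this

/-- The coefficient of t₁ in both glue vectors is 1/2, and 1/2 ≡ -1/2 modulo 1. Comparing the two
frames yields the reflection of T that proves symmetry. -/
theorem FullFrame.neg {k : ℤ} {t₁ t₂ x y : E.L} (h : FullFrame E k t₁ t₂ x y) :
    FullFrame E k (-t₁) t₂ (x - t₁) (y - t₁) where
  perp₁ := by simpa using h.perp₁.smul (-1)
  perp₂ := h.perp₂
  form₁ := by rw [map_neg, map_neg, LinearMap.neg_apply, neg_neg, h.form₁]
  form₁₂ := by rw [map_neg, LinearMap.neg_apply, h.form₁₂, neg_zero]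
  form₂ := h.form₂
  glue := by rw [smul_sub, h.glue]; module
  glue' := by rw [smul_sub, h.glue']; module
  span t ht := by
    obtain ⟨p, q, rfl⟩ := h.span t ht
    exact ⟨-p, q, by module⟩

theorem FullFrame.exists_basis {k : ℤ} {t₁ t₂ x y : E.L} (h : FullFrame E k t₁ t₂ x y) :
    ∃ b : Module.Basis (Fin 2) ℤ E.perp, (b 0).1 = t₁ ∧ (b 1).1 = t₂ := by
  let v : Fin 2 → E.perp := ![⟨t₁, mem_orthogonal_iff_isPerp.2 h.perp₁⟩,
    ⟨t₂, mem_orthogonal_iff_isPerp.2 h.perp₂⟩]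
  have hv : LinearIndependent ℤ v := by
    rw [Fintype.linearIndependent_iff]
    intro g hg
    rw [Fin.sum_univ_two] at hg
    have hg' : g 0 • t₁ + g 1 • t₂ = 0 := congrArg Subtype.val hg
    have h1 := congrArg (fun u => E.L.form u t₁) hg'
    have h2 := congrArg (fun u => E.L.form u t₂) hg'
    simp only [map_add, map_smul, LinearMap.add_apply, LinearMap.smul_apply, h.form₁, h.form₂,
      h.form₁₂, E.L.symm t₂ t₁, map_zero, LinearMap.zero_apply, smul_eq_mul] at h1 h2
    exact Fin.forall_fin_two.2 ⟨by omega, by omega⟩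
  refine ⟨Module.Basis.mk hv ?_, by rw [Module.Basis.mk_apply]; rfl,
    by rw [Module.Basis.mk_apply]; rfl⟩
  rintro ⟨t, ht⟩ -
  obtain ⟨p, q, hpq⟩ := h.span t (mem_orthogonal_iff_isPerp.1 ht)
  have : (⟨t, ht⟩ : E.perp) = p • v 0 + q • v 1 := Subtype.ext hpq
  rw [this]
  exact add_mem (Submodule.smul_mem _ _ (Submodule.subset_span ⟨0, rfl⟩))
    (Submodule.smul_mem _ _ (Submodule.subset_span ⟨1, rfl⟩))

theorem FullFrame.perp_isIsomorphic {k : ℤ} {t₁ t₂ x y : E.L} (h : FullFrame E k t₁ t₂ x y) :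
    E.perp.IsIsomorphic (latticeM 1 0 10) := by
  obtain ⟨b, hb₀, hb₁⟩ := h.exists_basis
  refine ⟨⟨b.equivFun, fun u v => ?_⟩⟩
  have h1 : ∀ u : E.perp, u.1 = b.equivFun u 0 • t₁ + b.equivFun u 1 • t₂ := fun u => by
    have := congrArg Subtype.val (b.sum_equivFun u)
    rw [Fin.sum_univ_two] at this
    rw [← hb₀, ← hb₁]
    exact this.symm
  have h2 : E.perp.form u v = E.L.form u.1 v.1 := rfl
  rw [h2, h1 u, h1 v]
  simp only [map_add, map_smul, LinearMap.add_apply, LinearMap.smul_apply, h.form₁, h.form₂,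
    h.form₁₂, E.L.symm t₂ t₁, smul_eq_mul, Matrix.toBilin'_apply, Fin.sum_univ_two]
  simp
  ring

end Extension

/-! ### Symmetry -/

theorem isMaxPosDef_top {L : EvenLattice} (h : ∀ x : L.realSpace, x ≠ 0 → 0 < L.realForm x x) :
    L.IsMaxPosDef ⊤ := ⟨fun x _ hx => h x hx, fun _ _ _ => le_top⟩

/-- An isometry of negative determinant of a positive definite lattice. -/
theorem isPlusDisorienting_of_det_neg {L : EvenLattice}
    (h : ∀ x : L.realSpace, x ≠ 0 → 0 < L.realForm x x) (t : Isometry L L)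
    (ht : LinearMap.det (t.toEquiv : L →ₗ[ℤ] L) < 0) : t.IsPlusDisorienting := by
  -- The maximal positive definite subspace is the whole space, so no projection is needed and p is
  -- t itself.
  let e : L.realSpace ≃ₗ[ℝ] (⊤ : Submodule ℝ L.realSpace) := Submodule.topEquiv.symm
  let p : (⊤ : Submodule ℝ L.realSpace) →ₗ[ℝ] (⊤ : Submodule ℝ L.realSpace) :=
    (e : L.realSpace →ₗ[ℝ] _) ∘ₗ t.real ∘ₗ (e.symm : _ →ₗ[ℝ] L.realSpace)
  refine ⟨⊤, p, isMaxPosDef_top h, fun x y => ?_, ?_⟩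
  · have : (p x).1 = t.real x := rfl
    rw [this, sub_self, map_zero]
  · rw [LinearMap.det_conj, Isometry.real, LinearMap.det_baseChange]
    simpa using ht

namespace Extension

variable {E : Extension (polarized (latticeA 19))}

theorem FullFrame.realForm_pos {k : ℤ} {t₁ t₂ x y : E.L} (h : FullFrame E k t₁ t₂ x y)
    (u : E.perp.realSpace) (hu : u ≠ 0) : 0 < E.perp.realForm u u := by
  obtain ⟨b, hb₀, hb₁⟩ := h.exists_basis
  let B := b.baseChange ℝ
  have hB : ∀ i j, E.perp.realForm (B i) (B j) = (E.L.form (b i).1 (b j).1 : ℝ) := fun i j => by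
    simp only [B, Module.Basis.baseChange_apply]
    rw [realForm, LinearMap.BilinForm.baseChange_tmul]
    simp
  have hu' := B.sum_equivFun u
  rw [Fin.sum_univ_two] at hu'
  have h0 : B.equivFun u ≠ 0 := fun h0 => hu (by simpa using h0)
  generalize B.equivFun u = c at hu' h0
  have h01 : c 0 ≠ 0 ∨ c 1 ≠ 0 := by
    by_contra! hc
    exact h0 (funext (Fin.forall_fin_two.2 hc))
  rw [← hu']
  simp only [map_add, map_smul, LinearMap.add_apply, LinearMap.smul_apply, hB, hb₀, hb₁, h.form₁,
    h.form₂, h.form₁₂, E.L.symm t₂ t₁, smul_eq_mul]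
  push_cast
  rcases h01 with h1 | h1
  · nlinarith [mul_self_pos.2 h1, mul_self_nonneg (c 1)]
  · nlinarith [mul_self_pos.2 h1, mul_self_nonneg (c 0)]

theorem FullFrame.isSymmetric {k : ℤ} {t₁ t₂ x y : E.L} (h : FullFrame E k t₁ t₂ x y)
    (hE : E.L.IsNondegenerate) (σ : Set (latticeA 19)) : IsSymmetric σ E := by
  obtain ⟨f, hf, hf₁, hf₂⟩ := h.exists_isometry h.neg hE hE
  have hmap : (E.L.form.orthogonal E.hull).map (f.toEquiv : E.L →ₗ[ℤ] E.L) =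
      E.L.form.orthogonal E.hull := by
    ext t
    rw [Submodule.mem_map, mem_orthogonal_iff_isPerp]
    constructor
    · rintro ⟨u, hu, rfl⟩ s
      rw [mem_orthogonal_iff_isPerp] at hu
      rw [← hf]
      exact (f.form_map _ _).trans (hu s)
    · intro ht
      refine ⟨f.toEquiv.symm t, mem_orthogonal_iff_isPerp.2 fun s => ?_,
        f.toEquiv.apply_symm_apply t⟩
      rw [← f.form_map, LinearEquiv.apply_symm_apply, hf, ht]
  let t : Isometry E.perp E.perp :=
    ⟨f.toEquiv.ofSubmodules _ _ hmap, fun u v => f.form_map u.1 v.1⟩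
  refine ⟨f, ⟨Isometry.refl _, refl_mem_admissible σ, hf⟩, t, fun _ => rfl,
    isPlusDisorienting_of_det_neg h.realForm_pos t ?_⟩
  obtain ⟨b, hb₀, hb₁⟩ := h.exists_basis
  have ht₀ : t.toEquiv (b 0) = -b 0 := Subtype.ext (by
    change f (b 0).1 = -(b 0).1
    rw [hb₀, hf₁])
  have ht₁ : t.toEquiv (b 1) = b 1 := Subtype.ext (by
    change f (b 1).1 = (b 1).1
    rw [hb₁, hf₂])
  rw [← LinearMap.det_toMatrix b, Matrix.det_fin_two]
  simp only [LinearMap.toMatrix_apply, LinearEquiv.coe_coe, ht₀, ht₁]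
  simp

/-- The hull of S is S itself, so the condition on the hull is automatic. -/
theorem isHomologicalType_of_isIsomorphic (hK : E.L.IsIsomorphic latticeK3) :
    IsHomologicalType E :=
  ⟨hK, isConfiguration_of_surjective hullExtension_emb_surjective⟩

end Extension

/-! ### Realization of the two types and conclusion -/

theorem ofCoords_add (c d : Fin 22 → ℤ) : ofCoords (c + d) = ofCoords c + ofCoords d := by
  refine Prod.ext ?_ (Prod.ext ?_ (Prod.ext ?_ (Prod.ext ?_ ?_))) <;> ext i <;> fin_cases i <;> rfl

/-- `ofCoords` as a homomorphism. -/
def ofCoordsHom : (Fin 22 → ℤ) →+ latticeK3 := AddMonoidHom.mk' ofCoords ofCoords_add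

/-- The abstract homological type defined by a table of coordinates. -/
theorem exists_glueFrame_of_table {c : Fin 23 → Fin 22 → ℤ} {k : ℤ}
    (gram : ∀ i j : Fin 22,
      latticeK3.form (ofCoords (c i.castSucc)) (ofCoords (c j.castSucc)) =
        if hi : (i : ℕ) < 19 then
          if hj : (j : ℕ) < 19 then -CartanMatrix.A 19 ⟨i, hi⟩ ⟨j, hj⟩ else 0
        else if i = j then if i = 21 then 20 else 2 else 0)
    (glue : ∀ m : Fin 22, 20 * c 22 m =
      ∑ i : Fin 19, ((i : ℤ) - 19) * c (i.castLE (by decide)) m + 10 * c 20 m + k * c 21 m) :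
    ∃ E : Extension (polarized (latticeA 19)), E.L.IsIsomorphic latticeK3 ∧
      ∃ t₁ t₂ x, Extension.GlueFrame E k t₁ t₂ x := by
  -- Rows 0 to 18 are the simple roots, 19 is h, 20 and 21 are t₁ and t₂, and 22 is the glue vector.
  let v : Fin 19 → latticeK3 := fun i => ofCoords (c (i.castLE (by decide)))
  let w : latticeK3 := ofCoords (c 19)
  have hv : ∀ i j, latticeK3.form (v i) (v j) = -CartanMatrix.A 19 i j := fun i j =>
    (gram (i.castLE (by decide)) (j.castLE (by decide))).trans
      ((dif_pos i.isLt).trans (dif_pos j.isLt))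
  have hvw : ∀ i, latticeK3.form (v i) w = 0 := fun i =>
    (gram (i.castLE (by decide)) 19).trans ((dif_pos i.isLt).trans (dif_neg (by decide)))
  let E := extensionOfGram v w hv hvw (gram 19 19)
  have hroot : ∀ i, E.root i = v i := fun i => by
    change ∑ j, (Pi.single i 1 : Fin 19 → ℤ) j • v j + (0 : ℤ) • w = v i
    rw [zero_smul, add_zero, Finset.sum_eq_single i]
    · simp
    · intro j _ hj
      rw [Pi.single_eq_of_ne hj, zero_smul]
    · simp
  have hpol : E.polarization = w := by
    change ∑ j, (0 : Fin 19 → ℤ) j • v j + (1 : ℤ) • w = w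
    simp
  have hweight : E.weight = ∑ i : Fin 19, ((i : ℤ) - 19) • v i := by
    change ∑ j : Fin 19, ((j : ℤ) - 19) • v j + (0 : ℤ) • w = _
    rw [zero_smul, add_zero]
  have hperp : ∀ j : Fin 22, 20 ≤ (j : ℕ) → E.IsPerp (ofCoords (c j.castSucc)) := fun j hj => by
    refine Extension.isPerp_of_root (fun i => ?_) ?_
    · rw [hroot]
      exact (latticeK3.symm _ _).trans ((gram (i.castLE (by decide)) j).trans
        ((dif_pos i.isLt).trans (dif_neg (by omega))))
    · rw [hpol]
      refine (gram j 19).trans ?_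
      rw [dif_neg (by omega), if_neg (by rintro rfl; revert hj; decide)]
  refine ⟨E, ⟨Isometry.refl _⟩, ofCoords (c 20), ofCoords (c 21), ofCoords (c 22),
    hperp 20 (by decide), hperp 21 (by decide), gram 20 20, gram 20 21, gram 21 21, ?_⟩
  have h1 : (20 : ℤ) • c 22 = ∑ i : Fin 19, ((i : ℤ) - 19) • c (i.castLE (by decide)) +
      (10 : ℤ) • c 20 + k • c 21 := by
    ext m
    simpa [Finset.sum_apply] using glue m
  have h2 := congrArg ofCoordsHom h1
  rw [map_add, map_add, map_sum, map_zsmul, map_zsmul, map_zsmul] at h2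
  rw [hweight]
  refine h2.trans ?_
  congr 2
  exact Finset.sum_congr rfl fun i _ => map_zsmul _ _ _

end EvenLattice

end

theorem proposition5p4p2 :
    ∃ C : Extension (polarized (latticeA 19)),
      IsConfiguration C ∧
      (∀ C' : Extension (polarized (latticeA 19)),
        IsConfiguration C' → AreIsomorphic (basisA 19) C' C) ∧
      ∃ H₁ H₂ : Extension (polarized (latticeA 19)),
        IsHomologicalType H₁ ∧ IsHomologicalType H₂ ∧
        AreIsomorphic (basisA 19) H₁.hullExtension C ∧
        AreIsomorphic (basisA 19) H₂.hullExtension C ∧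
        ¬ AreIsomorphic (basisA 19) H₁ H₂ ∧
        (∀ H : Extension (polarized (latticeA 19)), IsHomologicalType H →
          AreIsomorphic (basisA 19) H H₁ ∨ AreIsomorphic (basisA 19) H H₂) ∧
        IsSymmetric (basisA 19) H₁ ∧ IsSymmetric (basisA 19) H₂ ∧
        H₁.perp.IsIsomorphic (latticeM 1 0 10) ∧
        H₂.perp.IsIsomorphic (latticeM 1 0 10) := by
  -- Kinds 3 and 7 exclude each other, since neither 3 - 7 nor 3 + 7 is divisible by 20.
  have frame : ∀ {k l : ℤ} {E : Extension (polarized (latticeA 19))} {t₁ t₂ x y u₁ u₂ x' : E.L},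
      Extension.FullFrame E k t₁ t₂ x y → Extension.GlueFrame E l u₁ u₂ x' →
        k = 3 ∧ l = 7 ∨ k = 7 ∧ l = 3 → False := fun h h' hkl => by
    obtain ⟨n, hn⟩ := h.congr_of_glueFrame h'
    omega
  have unimodular : ∀ {E : Extension (polarized (latticeA 19))}, E.L.IsIsomorphic latticeK3 →
      E.L.IsNondegenerate := fun hK =>
    (hK.elim fun f => isUnimodular_latticeK3.of_isometry f).isNondegenerate
  have surj : Function.Surjective (Extension.refl (polarized (latticeA 19))).emb := fun x => ⟨x, rfl⟩
  obtain ⟨H₁, hK₁, _, _, _, g₁⟩ := exists_glueFrame_of_table gram_coordsOne glue_coordsOne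
  obtain ⟨H₂, hK₂, _, _, _, g₂⟩ := exists_glueFrame_of_table gram_coordsTwo glue_coordsTwo
  -- The table supplies only one glue vector; a full frame exists by the classification, and the
  -- glue vector decides its kind.
  obtain ⟨_, _, _, _, f₁⟩ : ∃ t₁ t₂ x y, Extension.FullFrame H₁ 3 t₁ t₂ x y := by
    rcases Extension.exists_fullFrame hK₁ with h | ⟨_, _, _, _, h⟩
    · exact h
    · exact (frame h g₁ (Or.inr ⟨rfl, rfl⟩)).elim
  obtain ⟨_, _, _, _, f₂⟩ : ∃ t₁ t₂ x y, Extension.FullFrame H₂ 7 t₁ t₂ x y := by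
    rcases Extension.exists_fullFrame hK₂ with ⟨_, _, _, _, h⟩ | h
    · exact (frame h g₂ (Or.inl ⟨rfl, rfl⟩)).elim
    · exact h
  refine ⟨Extension.refl _, Extension.isConfiguration_of_surjective surj, fun C' hC' =>
    Extension.areIsomorphic_of_surjective hC'.emb_surjective surj _, H₁, H₂,
    Extension.isHomologicalType_of_isIsomorphic hK₁,
    Extension.isHomologicalType_of_isIsomorphic hK₂,
    Extension.areIsomorphic_of_surjective Extension.hullExtension_emb_surjective surj _,
    Extension.areIsomorphic_of_surjective Extension.hullExtension_emb_surjective surj _,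
    fun h => ?_, fun H hH => ?_, f₁.isSymmetric (unimodular hK₁) _,
    f₂.isSymmetric (unimodular hK₂) _, f₁.perp_isIsomorphic, f₂.perp_isIsomorphic⟩
  · obtain ⟨_, _, _, h'⟩ := g₁.exists_of_areIsomorphic h
    exact frame f₂ h' (Or.inr ⟨rfl, rfl⟩)
  · rcases Extension.exists_fullFrame hH.isK3 with ⟨_, _, _, _, h⟩ | ⟨_, _, _, _, h⟩
    · obtain ⟨f, hf, -⟩ := h.exists_isometry f₁ (unimodular hH.isK3) (unimodular hK₁)
      exact Or.inl (areIsomorphic_of_emb _ f hf)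
    · obtain ⟨f, hf, -⟩ := h.exists_isometry f₂ (unimodular hH.isK3) (unimodular hK₂)
      exact Or.inr (areIsomorphic_of_emb _ f hf)
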